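/- **Conventions.** For a $C^*$-algebra $A$ (not necessarily unital), $A^{**}$ denotes its enveloping von Neumann algebra, i.e. the double commutant $\pi_u(A)''$, where $\pi_u$ is the universal representation of $A$ (the direct sum of the GNS representations of all states), and $A$ is regarded as a subalgebra of $A^{**}$ through $\pi_u$. The weak* topology of a von Neumann algebra $M\subset B(H)$ is the relative ultraweak topology, and a *-homomorphism is normal if it is weak*-weak* continuous. For $C^*$-algebras $A,B$, let $A\odot B$ be the algebraic tensor product and $A\otimes_{\max}B$ its completion in the maximal $C^*$-norm $$\|x\|_{\max}=\sup\Big\{\Big\|\sum_j\pi(a_j)\rho(b_j)\Big\|\Big\},\qquad x=\sum_j a_j\otimes b_j,$$ the supremum being over all pairs of *-representations $\pi$ of $A$ and $\rho$ of $B$ with commuting ranges on a common Hilbert space. Let $M,N$ be von Neumann algebras. A *weak\* tensor product* $M\overline\otimes_\alpha N$ of $M$ and $N$ is the weak* closure of $\alpha(M\odot N)$ in $B(K)$, where $\alpha:M\odot N\to B(K)$ is an injective unital *-representation such that $a\mapsto\alpha(a\otimes 1)$ and $b\mapsto\alpha(1\otimes b)$ are weak* homeomorphisms of $M$ and $N$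 onto their ranges. A weak* tensor product $M\overline\otimes_\alpha N$ is *maximal*, written $M\overline\otimes_{w^*\text{-max}}N$, if for every weak* tensor product $M\overline\otimes_\beta N$ the map $\alpha(x)\mapsto\beta(x)$, $x\in M\odot N$, extends to a normal *-homomorphism of $M\overline\otimes_\alpha N$ onto $M\overline\otimes_\beta N$. **Proposition.** Let $A$ and $B$ be nonzero $C^*$-algebras. Then the maximal weak* tensor product of $A^{**}$ and $B^{**}$ exists, and the identity map on $A\odot B$ extends to a normal *-isomorphism $$(A\otimes_{\max}B)^{**}\;\cong\;A^{**}\,\overline\otimes_{w^*\text{-max}}\,B^{**}.$$ That is, for every $\alpha$ for which $A^{**}\overline\otimes_\alpha B^{**}$ is a maximal weak* tensor product there is a *-isomorphism $\Phi:(A\otimes_{\max}B)^{**}\to A^{**}\overline\otimes_{\alpha}B^{**}$, weak* continuous together with its inverse, such that $\Phi(x)=\alpha(x)$ for all $x\in A\odot B$ (viewed in $A\otimes_{\max}B\subset(A\otimes_{\max}B)^{**}$ on the left and in $A^{**}\odot B^{**}$ on the right). -/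

import Mathlib

open scoped TensorProduct InnerProductSpace ComplexOrder ENNReal Topology

universe u v w

noncomputable section

/-! ### The maximal tensor product of C*-algebras -/

/-- A pair of commuting *-representations of `A` and `B` on a Hilbert space `H`. -/
structure CommutingPair (A : Type u) (B : Type v) [NonUnitalCStarAlgebra A]
    [NonUnitalCStarAlgebra B] (H : Type w) [NormedAddCommGroup H] [InnerProductSpace ℂ H]
    [CompleteSpace H] where
  left : A →⋆ₙₐ[ℂ] (H →L[ℂ] H)
  right : B →⋆ₙₐ[ℂ] (H →L[ℂ] H)
  commute : ∀ a b, Commute (left a) (right b)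

namespace CommutingPair

variable {A : Type u} {B : Type v} [NonUnitalCStarAlgebra A] [NonUnitalCStarAlgebra B]
  {H : Type w} [NormedAddCommGroup H] [InnerProductSpace ℂ H] [CompleteSpace H]

/-- The representation `a ⊗ b ↦ π(a) ρ(b)` of the algebraic tensor product. -/
def prod (p : CommutingPair A B H) : A ⊗[ℂ] B →ₗ[ℂ] (H →L[ℂ] H) :=
  TensorProduct.lift <| LinearMap.mk₂ ℂ (fun a b => p.left a * p.right b)
    (fun a a' b => by simp [add_mul]) (fun c a b => by simp)
    (fun a b b' => by simp [mul_add]) (fun c a b => by simp)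

@[simp]
theorem prod_tmul (p : CommutingPair A B H) (a : A) (b : B) :
    p.prod (a ⊗ₜ[ℂ] b) = p.left a * p.right b := rfl

theorem prod_mul (p : CommutingPair A B H) (x y : A ⊗[ℂ] B) :
    p.prod (x * y) = p.prod x * p.prod y := by
  induction x with
  | zero => simp
  | add x x' hx hx' => simp only [add_mul, map_add, hx, hx']
  | tmul a b =>
    induction y with
    | zero => simp
    | add y y' hy hy' => simp only [mul_add, map_add, hy, hy']
    | tmul a' b' =>
      simp only [Algebra.TensorProduct.tmul_mul_tmul, prod_tmul, map_mul, mul_assoc]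
      rw [← mul_assoc (p.left a') (p.right b), (p.commute a' b).eq, mul_assoc]

theorem prod_star (p : CommutingPair A B H) (x : A ⊗[ℂ] B) :
    p.prod (star x) = star (p.prod x) := by
  induction x with
  | zero => simp
  | add x x' hx hx' => simp only [star_add, map_add, hx, hx']
  | tmul a b =>
    simp only [TensorProduct.star_tmul, prod_tmul, map_star, star_mul]
    rw [← map_star, ← map_star, (p.commute (star a) (star b)).eq]

end CommutingPair

section MaxNorm

variable {A : Type u} {B : Type v} [NonUnitalCStarAlgebra A] [NonUnitalCStarAlgebra B]

/-- The numbers `‖(π × ρ)(x)‖`, for commuting representations `π` of `A` and `ρ` of `B`. -/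
def maxNormSet (x : A ⊗[ℂ] B) : Set ℝ :=
  {r | ∃ (H : Type (max u v)) (_ : NormedAddCommGroup H) (_ : InnerProductSpace ℂ H)
    (_ : CompleteSpace H) (p : CommutingPair A B H), r = ‖p.prod x‖}

theorem maxNormSet_bddAbove (x : A ⊗[ℂ] B) : BddAbove (maxNormSet x) := by
  induction x with
  | zero => exact ⟨0, by rintro r ⟨H, _, _, _, p, rfl⟩; simp⟩
  | tmul a b =>
    refine ⟨‖a‖ * ‖b‖, ?_⟩
    rintro r ⟨H, _, _, _, p, rfl⟩
    refine (norm_mul_le _ _).trans ?_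
    gcongr
    · exact NonUnitalStarAlgHom.norm_apply_le p.left a
    · exact NonUnitalStarAlgHom.norm_apply_le p.right b
  | add x y hx hy =>
    obtain ⟨C, hC⟩ := hx
    obtain ⟨D, hD⟩ := hy
    refine ⟨C + D, ?_⟩
    rintro r ⟨H, _, _, _, p, rfl⟩
    rw [map_add]
    exact (norm_add_le _ _).trans
      (add_le_add (hC ⟨H, _, _, _, p, rfl⟩) (hD ⟨H, _, _, _, p, rfl⟩))

theorem maxNormSet_nonempty (x : A ⊗[ℂ] B) : (maxNormSet x).Nonempty :=
  ⟨_, PUnit, inferInstance, inferInstance, inferInstance,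
    ⟨0, 0, fun _ _ => Commute.zero_left _⟩, rfl⟩

/-- The maximal C*-norm on the algebraic tensor product. -/
def maxNorm (x : A ⊗[ℂ] B) : ℝ := sSup (maxNormSet x)

theorem norm_prod_le_maxNorm {H : Type (max u v)} [NormedAddCommGroup H] [InnerProductSpace ℂ H]
    [CompleteSpace H] (p : CommutingPair A B H) (x : A ⊗[ℂ] B) : ‖p.prod x‖ ≤ maxNorm x :=
  le_csSup (maxNormSet_bddAbove x) ⟨H, _, _, _, p, rfl⟩

theorem maxNorm_le {x : A ⊗[ℂ] B} {C : ℝ}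
    (h : ∀ (H : Type (max u v)) [NormedAddCommGroup H] [InnerProductSpace ℂ H]
      [CompleteSpace H] (p : CommutingPair A B H), ‖p.prod x‖ ≤ C) : maxNorm x ≤ C := by
  refine csSup_le (maxNormSet_nonempty x) ?_
  rintro r ⟨H, _, _, _, p, rfl⟩
  exact h H p

theorem maxNorm_nonneg (x : A ⊗[ℂ] B) : 0 ≤ maxNorm x := by
  obtain ⟨r, H, _, _, _, p, rfl⟩ := maxNormSet_nonempty x
  exact (norm_nonneg _).trans (norm_prod_le_maxNorm p x)

theorem maxNorm_mul_le (x y : A ⊗[ℂ] B) : maxNorm (x * y) ≤ maxNorm x * maxNorm y := by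
  refine maxNorm_le fun H _ _ _ p => ?_
  rw [p.prod_mul]
  exact (norm_mul_le _ _).trans (mul_le_mul (norm_prod_le_maxNorm p x)
    (norm_prod_le_maxNorm p y) (norm_nonneg _) (maxNorm_nonneg x))

theorem maxNorm_star_le (x : A ⊗[ℂ] B) : maxNorm (star x) ≤ maxNorm x := by
  refine maxNorm_le fun H _ _ _ p => ?_
  rw [p.prod_star, norm_star]
  exact norm_prod_le_maxNorm p x

theorem maxNorm_mul_self_le (x : A ⊗[ℂ] B) :
    maxNorm x * maxNorm x ≤ maxNorm (star x * x) := by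
  have h : maxNorm x ≤ √(maxNorm (star x * x)) := by
    refine maxNorm_le fun H _ _ _ p => Real.le_sqrt_of_sq_le ?_
    rw [sq, ← CStarRing.norm_star_mul_self, ← p.prod_star, ← p.prod_mul]
    exact norm_prod_le_maxNorm p _
  calc maxNorm x * maxNorm x
      ≤ √(maxNorm (star x * x)) * √(maxNorm (star x * x)) :=
        mul_le_mul h h (maxNorm_nonneg x) (Real.sqrt_nonneg _)
    _ = maxNorm (star x * x) := Real.mul_self_sqrt (maxNorm_nonneg _)

variable (A B)

/-- The algebraic tensor product `A ⊙ B`, to be equipped with the maximal C*-norm. -/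
def AlgTensor : Type (max u v) := A ⊗[ℂ] B

namespace AlgTensor

instance : NonUnitalRing (AlgTensor A B) := inferInstanceAs (NonUnitalRing (A ⊗[ℂ] B))

instance : Module ℂ (AlgTensor A B) := inferInstanceAs (Module ℂ (A ⊗[ℂ] B))

instance : IsScalarTower ℂ (AlgTensor A B) (AlgTensor A B) :=
  inferInstanceAs (IsScalarTower ℂ (A ⊗[ℂ] B) (A ⊗[ℂ] B))

instance : SMulCommClass ℂ (AlgTensor A B) (AlgTensor A B) :=
  inferInstanceAs (SMulCommClass ℂ (A ⊗[ℂ] B) (A ⊗[ℂ] B))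

instance : StarAddMonoid (AlgTensor A B) := inferInstanceAs (StarAddMonoid (A ⊗[ℂ] B))

instance : StarModule ℂ (AlgTensor A B) := inferInstanceAs (StarModule ℂ (A ⊗[ℂ] B))

theorem star_mul_aux (x y : A ⊗[ℂ] B) : star (x * y) = star y * star x := by
  induction x with
  | zero => simp
  | add x x' hx hx' => simp only [add_mul, mul_add, star_add, hx, hx']
  | tmul a b =>
    induction y with
    | zero => simp
    | add y y' hy hy' => simp only [add_mul, mul_add, star_add, hy, hy']
    | tmul a' b' => simp

instance : StarRing (AlgTensor A B) where
  star_mul := star_mul_aux A B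
  star_add := star_add

/-- The maximal C*-norm, as a seminorm. -/
def maxSeminorm : Seminorm ℂ (A ⊗[ℂ] B) :=
  Seminorm.ofSMulLE maxNorm
    (le_antisymm (maxNorm_le fun H _ _ _ p => by simp) (maxNorm_nonneg _))
    (fun x y => maxNorm_le fun H _ _ _ p => by
      rw [map_add]
      exact (norm_add_le _ _).trans
        (add_le_add (norm_prod_le_maxNorm p x) (norm_prod_le_maxNorm p y)))
    (fun c x => maxNorm_le fun H _ _ _ p => by
      rw [map_smul, norm_smul]
      exact mul_le_mul_of_nonneg_left (norm_prod_le_maxNorm p x) (norm_nonneg _))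

instance : NonUnitalSeminormedRing (AlgTensor A B) where
  __ : NonUnitalRing (AlgTensor A B) := inferInstance
  norm := maxNorm (A := A) (B := B)
  dist x y := maxSeminorm A B (-x + y)
  dist_eq x y := rfl
  dist_self x := (congrArg (maxSeminorm A B) (neg_add_cancel x)).trans (map_zero _)
  dist_comm x y := by
    refine (map_neg_eq_map (maxSeminorm A B) _).symm.trans (congrArg (maxSeminorm A B) ?_)
    exact (neg_add_rev (-x) y).trans (by rw [neg_neg])
  dist_triangle x y z := by
    refine le_trans (le_of_eq (congrArg (maxSeminorm A B) ?_))
      (map_add_le_add (maxSeminorm A B) (-x + y) (-y + z))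
    change -x + z = -x + y + (-y + z)
    abel
  norm_mul_le := maxNorm_mul_le (A := A) (B := B)

instance : NormedSpace ℂ (AlgTensor A B) where
  norm_smul_le c x := (map_smul_eq_mul (maxSeminorm A B) c x).le

instance : NormedStarGroup (AlgTensor A B) where
  norm_star_le := maxNorm_star_le (A := A) (B := B)

theorem norm_mul_self_le (x : AlgTensor A B) : ‖x‖ * ‖x‖ ≤ ‖star x * x‖ :=
  maxNorm_mul_self_le (A := A) (B := B) x

end AlgTensor

open UniformSpace UniformSpace.Completion

/-- The maximal tensor product `A ⊗_max B`: the completion of `A ⊙ B` in the maximal C*-norm. -/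
abbrev MaxTensor : Type (max u v) := Completion (AlgTensor A B)

namespace MaxTensor

/-- The multiplication of `A ⊗_max B`, extending that of `A ⊙ B` by continuity. -/
instance : Mul (MaxTensor A B) :=
  ⟨fun x y => (isDenseInducing_coe.prodMap isDenseInducing_coe).extend
    (fun p : AlgTensor A B × AlgTensor A B => ((p.1 * p.2 : AlgTensor A B) : MaxTensor A B))
    (x, y)⟩

/-- The involution of `A ⊗_max B`, extending that of `A ⊙ B` by continuity. -/
instance : Star (MaxTensor A B) := ⟨Completion.map star⟩

variable {A B}

theorem coe_mul' (x y : AlgTensor A B) : ((x * y : AlgTensor A B) : MaxTensor A B) = x * y :=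
  ((isDenseInducing_coe.prodMap isDenseInducing_coe).extend_eq
    ((continuous_coe (AlgTensor A B)).comp (continuous_mul (M := AlgTensor A B))) (x, y)).symm

theorem uniformContinuous_star' : UniformContinuous (star : AlgTensor A B → AlgTensor A B) :=
  (starNormedAddGroupHom (E := AlgTensor A B)).uniformContinuous

theorem coe_star' (x : AlgTensor A B) :
    ((star x : AlgTensor A B) : MaxTensor A B) = star (x : MaxTensor A B) :=
  (map_coe uniformContinuous_star' x).symm

instance : ContinuousMul (MaxTensor A B) where
  continuous_mul := by
    let m := (AddMonoidHom.mul : AlgTensor A B →+ AlgTensor A B →+ AlgTensor A B).compr₂ toCompl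
    have hm : Continuous fun p : AlgTensor A B × AlgTensor A B => m p.1 p.2 :=
      (continuous_coe _).comp continuous_mul
    have di : IsDenseInducing (toCompl : AlgTensor A B → MaxTensor A B) := isDenseInducing_coe
    exact (di.extend_Z_bilin di hm :)

instance : ContinuousStar (MaxTensor A B) where
  continuous_star := continuous_map

instance : NonUnitalRing (MaxTensor A B) where
  __ : AddCommGroup (MaxTensor A B) := inferInstance
  zero_mul x := by
    induction x using Completion.induction_on with
    | hp => exact isClosed_eq (by fun_prop) (by fun_prop)
    | ih x => rw [← coe_zero, ← coe_mul', zero_mul]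
  mul_zero x := by
    induction x using Completion.induction_on with
    | hp => exact isClosed_eq (by fun_prop) (by fun_prop)
    | ih x => rw [← coe_zero, ← coe_mul', mul_zero]
  left_distrib x y z := by
    induction x, y, z using Completion.induction_on₃ with
    | hp => exact isClosed_eq (by fun_prop) (by fun_prop)
    | ih x y z => rw [← coe_add, ← coe_mul', ← coe_mul', ← coe_mul', ← coe_add, mul_add]
  right_distrib x y z := by
    induction x, y, z using Completion.induction_on₃ with
    | hp => exact isClosed_eq (by fun_prop) (by fun_prop)
    | ih x y z => rw [← coe_add, ← coe_mul', ← coe_mul', ← coe_mul', ← coe_add, add_mul]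
  mul_assoc x y z := by
    induction x, y, z using Completion.induction_on₃ with
    | hp => exact isClosed_eq (by fun_prop) (by fun_prop)
    | ih x y z => rw [← coe_mul', ← coe_mul', ← coe_mul', ← coe_mul', mul_assoc]

instance : NonUnitalNormedRing (MaxTensor A B) where
  __ : NormedAddCommGroup (MaxTensor A B) := inferInstance
  __ : NonUnitalRing (MaxTensor A B) := inferInstance
  norm_mul_le x y := by
    induction x, y using Completion.induction_on₂ with
    | hp => exact isClosed_le (by fun_prop) (by fun_prop)
    | ih x y => simpa only [← coe_mul', norm_coe] using norm_mul_le x y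

instance : StarRing (MaxTensor A B) where
  star_involutive x := by
    induction x using Completion.induction_on with
    | hp => exact isClosed_eq (by fun_prop) (by fun_prop)
    | ih x => rw [← coe_star', ← coe_star', star_star]
  star_mul x y := by
    induction x, y using Completion.induction_on₂ with
    | hp => exact isClosed_eq (by fun_prop) (by fun_prop)
    | ih x y => rw [← coe_mul', ← coe_star', ← coe_star', ← coe_star', star_mul, coe_mul']
  star_add x y := by
    induction x, y using Completion.induction_on₂ with
    | hp => exact isClosed_eq (by fun_prop) (by fun_prop)
    | ih x y => rw [← coe_add, ← coe_star', ← coe_star', ← coe_star', star_add, coe_add]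

instance : CStarRing (MaxTensor A B) where
  norm_mul_self_le x := by
    induction x using Completion.induction_on with
    | hp => exact isClosed_le (by fun_prop) (by fun_prop)
    | ih x =>
      rw [← coe_star', ← coe_mul', norm_coe, norm_coe]
      exact AlgTensor.norm_mul_self_le A B x

theorem smul_mul' (c : ℂ) (x y : MaxTensor A B) : (c • x) * y = c • (x * y) := by
  have h₁ : Continuous fun p : MaxTensor A B × MaxTensor A B => (c • p.1) * p.2 :=
    ((continuous_const_smul c).comp continuous_fst).mul continuous_snd
  have h₂ : Continuous fun p : MaxTensor A B × MaxTensor A B => c • (p.1 * p.2) :=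
    (continuous_const_smul c).comp (continuous_fst.mul continuous_snd)
  induction x, y using Completion.induction_on₂ with
  | hp => exact isClosed_eq h₁ h₂
  | ih x y => rw [← coe_smul, ← coe_mul', ← coe_mul', ← coe_smul, smul_mul_assoc]

theorem mul_smul' (c : ℂ) (x y : MaxTensor A B) : x * (c • y) = c • (x * y) := by
  have h₁ : Continuous fun p : MaxTensor A B × MaxTensor A B => p.1 * (c • p.2) :=
    continuous_fst.mul ((continuous_const_smul c).comp continuous_snd)
  have h₂ : Continuous fun p : MaxTensor A B × MaxTensor A B => c • (p.1 * p.2) :=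
    (continuous_const_smul c).comp (continuous_fst.mul continuous_snd)
  induction x, y using Completion.induction_on₂ with
  | hp => exact isClosed_eq h₁ h₂
  | ih x y => rw [← coe_smul, ← coe_mul', ← coe_mul', ← coe_smul, mul_smul_comm]

instance : IsScalarTower ℂ (MaxTensor A B) (MaxTensor A B) := ⟨smul_mul'⟩

instance : SMulCommClass ℂ (MaxTensor A B) (MaxTensor A B) := ⟨fun c x y => (mul_smul' c x y).symm⟩

instance : StarModule ℂ (MaxTensor A B) where
  star_smul c x := by
    induction x using Completion.induction_on with
    | hp => exact isClosed_eq (continuous_id.const_smul c).star (continuous_star.const_smul (star c))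
    | ih x => rw [← coe_star', ← coe_smul, ← coe_smul, ← coe_star', star_smul]

instance : NonUnitalCStarAlgebra (MaxTensor A B) where

/-- The canonical map from `A ⊙ B` to `A ⊗_max B`. -/
def of : A ⊗[ℂ] B →ₗ[ℂ] MaxTensor A B :=
  (toComplₗᵢ (𝕜 := ℂ) (E := AlgTensor A B)).toLinearMap

end MaxTensor

end MaxNorm

/-! ### Hilbert sums of operators -/

section HilbertSum

variable {ι : Type w} {G : ι → Type u} [∀ i, NormedAddCommGroup (G i)]
  [∀ i, InnerProductSpace ℂ (G i)]

/-- The diagonal operator `⨁ T i` on the Hilbert sum of the `G i`, for a bounded family `T`. -/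
def diagOp (T : ∀ i, G i →L[ℂ] G i) (C : ℝ) (hT : ∀ i, ‖T i‖ ≤ C) : lp G 2 →L[ℂ] lp G 2 :=
  have hle (f : lp G 2) (i : ι) : ‖T i (f i)‖ ≤ ‖(C : ℂ) • f i‖ := by
    rw [norm_smul, Complex.norm_real, Real.norm_eq_abs]
    exact (T i).le_of_opNorm_le ((hT i).trans (le_abs_self C)) (f i)
  LinearMap.mkContinuous
    { toFun := fun f => ⟨fun i => T i (f i), ((lp.memℓp f).const_smul (C : ℂ)).mono' (hle f)⟩
      map_add' := fun f g => by ext i; simp; rfl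
      map_smul' := fun c f => by ext i; simp } |C| fun f => by
    have h : ‖f‖ * |C| = ‖(C : ℂ) • f‖ := by
      rw [norm_smul, Complex.norm_real, Real.norm_eq_abs, mul_comm]
    rw [mul_comm, h]
    exact lp.norm_mono (by norm_num) (hle f)

@[simp]
theorem diagOp_apply (T : ∀ i, G i →L[ℂ] G i) (C : ℝ) (hT : ∀ i, ‖T i‖ ≤ C) (f : lp G 2) (i : ι) :
    diagOp T C hT f i = T i (f i) := rfl

variable [∀ i, CompleteSpace (G i)] {A : Type v} [NonUnitalCStarAlgebra A]

/-- The Hilbert sum of a family of *-representations. -/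
def sumRep (π : ∀ i, A →⋆ₙₐ[ℂ] (G i →L[ℂ] G i)) : A →⋆ₙₐ[ℂ] (lp G 2 →L[ℂ] lp G 2) where
  toFun a := diagOp (fun i => π i a) ‖a‖ fun i => NonUnitalStarAlgHom.norm_apply_le (π i) a
  map_smul' c a := by ext f i; simp
  map_zero' := by ext f i; simp
  map_add' a b := by ext f i; simp
  map_mul' a b := by ext f i; simp
  map_star' a := by
    rw [ContinuousLinearMap.star_eq_adjoint]
    refine (ContinuousLinearMap.eq_adjoint_iff _ _).2 fun f g => ?_
    rw [lp.inner_eq_tsum, lp.inner_eq_tsum]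
    refine tsum_congr fun i => ?_
    rw [diagOp_apply, diagOp_apply, map_star, ContinuousLinearMap.star_eq_adjoint,
      ContinuousLinearMap.adjoint_inner_left]

end HilbertSum

/-! ### The enveloping von Neumann algebra -/

section Enveloping

variable (A : Type u) [NonUnitalCStarAlgebra A]

attribute [local instance] CStarAlgebra.spectralOrder CStarAlgebra.spectralOrderedRing

/-- The states of `A`: the positive functionals of norm one. -/
def CStarState : Type u := {f : StrongDual ℂ A // ‖f‖ = 1 ∧ ∀ a, 0 ≤ f (star a * a)}

variable {A} in
/-- A state, as a positive linear map for the usual order of `A`. -/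
def CStarState.toPositive (f : CStarState A) : A →ₚ[ℂ] ℂ :=
  PositiveLinearMap.mk₀ (f.1 : A →ₗ[ℂ] ℂ) fun x hx => by
    obtain ⟨y, rfl⟩ := CStarAlgebra.nonneg_iff_eq_star_mul_self.1 hx
    exact f.2.2 y

/-- The Hilbert space of the universal representation: the sum of the GNS spaces of all states. -/
abbrev UniversalSpace : Type u := lp (fun f : CStarState A => f.toPositive.GNS) 2

/-- The universal representation of `A`: the sum of the GNS representations of all states. -/
def universalRep : A →⋆ₙₐ[ℂ] (UniversalSpace A →L[ℂ] UniversalSpace A) :=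
  sumRep fun f : CStarState A => f.toPositive.gnsNonUnitalStarAlgHom

/-- The von Neumann algebra generated by a set of operators: its double commutant (after the
adjoints have been added to the set). -/
def bicommutant {H : Type w} [NormedAddCommGroup H] [InnerProductSpace ℂ H] [CompleteSpace H]
    (s : Set (H →L[ℂ] H)) : VonNeumannAlgebra H where
  toStarSubalgebra := StarSubalgebra.centralizer ℂ (StarSubalgebra.centralizer ℂ s : Set (H →L[ℂ] H))
  centralizer_centralizer' := Set.centralizer_centralizer_centralizer _

/-- The enveloping von Neumann algebra `A**` of `A`: the double commutant of the image of its
universal representation. -/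
def Enveloping : VonNeumannAlgebra (UniversalSpace A) := bicommutant (Set.range (universalRep A))

theorem universalRep_mem (a : A) : universalRep A a ∈ (Enveloping A).toStarSubalgebra := by
  refine (StarSubalgebra.mem_centralizer_iff ℂ).2 fun g hg => ⟨?_, ?_⟩
  · exact (((StarSubalgebra.mem_centralizer_iff ℂ).1 hg _ ⟨a, rfl⟩).1).symm
  · exact (((StarSubalgebra.mem_centralizer_iff ℂ).1 (star_mem hg) _ ⟨a, rfl⟩).1).symm

/-- The canonical map `A → A**`. -/
def toEnveloping : A →⋆ₙₐ[ℂ] (Enveloping A).toStarSubalgebra where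
  toFun a := ⟨universalRep A a, universalRep_mem A a⟩
  map_smul' c a := Subtype.ext (map_smul (universalRep A) c a)
  map_zero' := Subtype.ext (map_zero (universalRep A))
  map_add' a b := Subtype.ext (map_add (universalRep A) a b)
  map_mul' a b := Subtype.ext (map_mul (universalRep A) a b)
  map_star' a := Subtype.ext (map_star (universalRep A) a)

end Enveloping

/-! ### The weak* topology and weak* tensor products -/

section WeakStar

variable (H : Type u) [NormedAddCommGroup H] [InnerProductSpace ℂ H]

/-- The ultraweak (weak*) topology of `B(H)`: the coarsest one for which the functionals
`T ↦ ∑ ⟪x n, T (y n)⟫`, with `x` and `y` square summable sequences in `H`, are continuous. -/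
@[reducible] def ultraweak : TopologicalSpace (H →L[ℂ] H) :=
  ⨅ p : lp (fun _ : ℕ => H) 2 × lp (fun _ : ℕ => H) 2,
    TopologicalSpace.induced (fun T => ∑' n, ⟪p.1 n, T (p.2 n)⟫_ℂ) inferInstance

variable {H}

/-- The operator `T` applied to each member of a square summable sequence. -/
def ampl (T : H →L[ℂ] H) : lp (fun _ : ℕ => H) 2 →L[ℂ] lp (fun _ : ℕ => H) 2 :=
  diagOp (fun _ => T) ‖T‖ fun _ => le_rfl

theorem continuous_ultraweak_iff {X : Type*} [TopologicalSpace X] {f : X → H →L[ℂ] H} :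
    Continuous[_, ultraweak H] f ↔ ∀ x y : lp (fun _ : ℕ => H) 2,
      Continuous fun t => ∑' n, ⟪x n, f t (y n)⟫_ℂ := by
  rw [ultraweak, continuous_iInf_rng]
  simp only [continuous_induced_rng, Prod.forall]
  rfl

theorem continuous_functional (x y : lp (fun _ : ℕ => H) 2) :
    Continuous[ultraweak H, _] fun T : H →L[ℂ] H => ∑' n, ⟪x n, T (y n)⟫_ℂ :=
  letI := ultraweak H
  continuous_ultraweak_iff.1 continuous_id x y

theorem summable_functional (x y : lp (fun _ : ℕ => H) 2) (T : H →L[ℂ] H) :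
    Summable fun n => ⟪x n, T (y n)⟫_ℂ :=
  lp.summable_inner x (ampl T y)

variable [CompleteSpace H]

theorem isSemitopologicalSemiring_ultraweak :
    @IsSemitopologicalSemiring (H →L[ℂ] H) (ultraweak H) _ := by
  let _ := ultraweak H
  refine @IsSemitopologicalSemiring.mk _ _ _ (@ContinuousAdd.mk _ _ _ ?_)
    (@SeparatelyContinuousMul.mk _ _ _ ?_ ?_)
  · refine continuous_ultraweak_iff.2 fun x y => ?_
    have h (p : (H →L[ℂ] H) × (H →L[ℂ] H)) : ∑' n, ⟪x n, (p.1 + p.2) (y n)⟫_ℂ =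
        ∑' n, ⟪x n, p.1 (y n)⟫_ℂ + ∑' n, ⟪x n, p.2 (y n)⟫_ℂ := by
      rw [← (summable_functional x y p.1).tsum_add (summable_functional x y p.2)]
      simp
    simp only [h]
    exact ((continuous_functional x y).comp continuous_fst).add
      ((continuous_functional x y).comp continuous_snd)
  · intro a
    refine continuous_ultraweak_iff.2 fun x y => ?_
    have h (T : H →L[ℂ] H) : ∑' n, ⟪x n, (a * T) (y n)⟫_ℂ =
        ∑' n, ⟪ampl (star a) x n, T (y n)⟫_ℂ := by
      refine tsum_congr fun n => ?_
      rw [ampl, diagOp_apply, ContinuousLinearMap.star_eq_adjoint,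
        ContinuousLinearMap.adjoint_inner_left]
      rfl
    simp only [h]
    exact continuous_functional _ y
  · intro a
    exact continuous_ultraweak_iff.2 fun x y => continuous_functional x (ampl a y)

theorem continuousStar_ultraweak : @ContinuousStar (H →L[ℂ] H) (ultraweak H) _ := by
  let _ := ultraweak H
  refine @ContinuousStar.mk _ _ _ (continuous_ultraweak_iff.2 fun x y => ?_)
  have h (T : H →L[ℂ] H) : ∑' n, ⟪x n, (star T) (y n)⟫_ℂ = star (∑' n, ⟪y n, T (x n)⟫_ℂ) := by
    rw [tsum_star]
    refine tsum_congr fun n => ?_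
    rw [ContinuousLinearMap.star_eq_adjoint, ContinuousLinearMap.adjoint_inner_right]
    exact (inner_conj_symm _ _).symm
  simp only [h]
  exact (continuous_functional y x).star

/-- The weak* closure of a *-algebra of operators. -/
def weakStarClosure (S : StarSubalgebra ℂ (H →L[ℂ] H)) : StarSubalgebra ℂ (H →L[ℂ] H) :=
  letI := ultraweak H
  haveI : IsSemitopologicalSemiring (H →L[ℂ] H) := isSemitopologicalSemiring_ultraweak
  haveI : ContinuousStar (H →L[ℂ] H) := continuousStar_ultraweak
  S.topologicalClosure

theorem coe_weakStarClosure (S : StarSubalgebra ℂ (H →L[ℂ] H)) :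
    (weakStarClosure S : Set (H →L[ℂ] H)) = @closure _ (ultraweak H) (S : Set (H →L[ℂ] H)) := rfl

/-- The weak* topology of a weak* closed *-algebra of operators. -/
@[reducible] def weakStar (S : StarSubalgebra ℂ (H →L[ℂ] H)) : TopologicalSpace S :=
  TopologicalSpace.induced Subtype.val (ultraweak H)

variable {K : Type v} [NormedAddCommGroup K] [InnerProductSpace ℂ K] [CompleteSpace K]

/-- Normality of a map between weak* closed *-algebras: weak*-weak* continuity. -/
def IsNormalMap {S : StarSubalgebra ℂ (H →L[ℂ] H)} {T : StarSubalgebra ℂ (K →L[ℂ] K)}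
    (f : S → T) : Prop :=
  Continuous[weakStar S, weakStar T] f

/-- The algebraic tensor product `M ⊙ N` of von Neumann algebras. -/
abbrev AlgTensorVN (M : VonNeumannAlgebra H) (N : VonNeumannAlgebra K) : Type (max u v) :=
  M.toStarSubalgebra ⊗[ℂ] N.toStarSubalgebra

variable {M : VonNeumannAlgebra H} {N : VonNeumannAlgebra K}

section Tensor

variable {L : Type w} [NormedAddCommGroup L] [InnerProductSpace ℂ L] [CompleteSpace L]

/-- The conditions on a representation `α` of `M ⊙ N` that make the weak* closure of its range a
weak* tensor product: it is injective, and its restrictions to `M` and `N` are weak*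
homeomorphisms onto their ranges. -/
structure IsWeakStarTensor (α : AlgTensorVN M N →⋆ₐ[ℂ] (L →L[ℂ] L)) : Prop where
  injective : Function.Injective α
  left : @Topology.IsEmbedding _ _ (weakStar M.toStarSubalgebra) (ultraweak L)
    fun a => α (a ⊗ₜ[ℂ] 1)
  right : @Topology.IsEmbedding _ _ (weakStar N.toStarSubalgebra) (ultraweak L)
    fun b => α (1 ⊗ₜ[ℂ] b)

/-- The weak* tensor product `M ⊗̄_α N`: the weak* closure of `α(M ⊙ N)`. -/
def weakStarTensor (α : AlgTensorVN M N →⋆ₐ[ℂ] (L →L[ℂ] L)) : StarSubalgebra ℂ (L →L[ℂ] L) :=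
  weakStarClosure α.range

/-- `α(x)`, as an element of `M ⊗̄_α N`. -/
def toWeakStarTensor (α : AlgTensorVN M N →⋆ₐ[ℂ] (L →L[ℂ] L)) (x : AlgTensorVN M N) :
    weakStarTensor α :=
  ⟨α x, @subset_closure _ (ultraweak L) _ _ ⟨x, rfl⟩⟩

/-- `M ⊗̄_α N` is the maximal weak* tensor product `M ⊗̄_{w*-max} N`: it is a weak* tensor product,
and the identity of `M ⊙ N` extends to a normal *-homomorphism from it onto any other one. -/
def IsMaxWeakStarTensor (α : AlgTensorVN M N →⋆ₐ[ℂ] (L →L[ℂ] L)) : Prop :=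
  IsWeakStarTensor α ∧
    ∀ (L' : Type w) [NormedAddCommGroup L'] [InnerProductSpace ℂ L'] [CompleteSpace L']
      (β : AlgTensorVN M N →⋆ₐ[ℂ] (L' →L[ℂ] L')), IsWeakStarTensor β →
      ∃ Ψ : weakStarTensor α →⋆ₐ[ℂ] weakStarTensor β, IsNormalMap Ψ ∧ Function.Surjective Ψ ∧
        ∀ x, Ψ (toWeakStarTensor α x) = toWeakStarTensor β x

end Tensor

end WeakStar

/-- The canonical map `A ⊙ B → A** ⊙ B**`. -/
def algTensorToEnveloping (A : Type u) (B : Type v) [NonUnitalCStarAlgebra A]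
    [NonUnitalCStarAlgebra B] : A ⊗[ℂ] B →ₗ[ℂ] AlgTensorVN (Enveloping A) (Enveloping B) :=
  TensorProduct.map (toEnveloping A : A →ₗ[ℂ] (Enveloping A).toStarSubalgebra)
    (toEnveloping B : B →ₗ[ℂ] (Enveloping B).toStarSubalgebra)

end

/-!
Let `C` be `A ⊗_max B`. Three facts about enveloping von Neumann algebras carry the proof.

* Every nondegenerate representation `π` of a C*-algebra `A` extends to a normal homomorphism of
  `A**` onto `π(A)''` (`exists_normal_extension`). Each nonzero vector of `π` is, up to a scalar, the
  GNS vector of a state, so it is the image, under a contractive intertwiner from the universal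
  representation, of a vector of no greater norm. Elements of the double commutant are transported
  along these intertwiners, and so are the functionals that define the ultraweak topology, which
  gives normality.
* `A` is weak* dense in `A**` (`eq_of_continuous_weakStar`), because of the double commutant theorem
  for nondegenerate *-algebras (`bicommutant_subset_closure`). So normal maps on `A**`, and separately
  normal maps on `A** × B**`, are determined by their restrictions to `A` and `B`.
* The nondegenerate representations of `C` are the products of commuting representations of `A` and
  `B` (`MaxTensor.isMaximalProduct`): for the direction from `C` to the pair, `A` and `B` act as
  multipliers of `A ⊙ B`, and approximate units show that these multipliers are bounded.

If `β` is a representation of `A** ⊙ B**` whose restrictions to the factors are normal, then its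
restriction to `A ⊙ B` extends to `C` and hence to a normal homomorphism of `C**` onto the weak*
closure of the range of `β` (`IsSeparatelyNormal.exists_lift`). Conversely, the universal
representation of `C` comes from commuting representations of `A` and `B`, whose normal extensions
commute, and these define the canonical representation `α` of `A** ⊙ B**` on the universal space of
`C`. The weak* closure of its range is `C**` (`weakStarTensor_eq_enveloping`).

The canonical representation is a weak* tensor product (`isWeakStarTensor_canonical`): the lift of the
spatial representation of `A** ⊙ B**` on the Hilbert tensor product of the universal spaces recovers
the spatial representation along `α`, so `α` is injective since the spatial representation is, and the
weak* topologies of `A**` and `B**` are recovered through compressions to the subspaces `ξ ⊗ e` and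
`e ⊗ η`. It is maximal because every weak* tensor product has a lift. If `β` is any maximal weak*
tensor product, then its lift from `C**` is inverted by the homomorphism onto the canonical one that
maximality of `β` provides.
-/

noncomputable section

/-! ### Transporting operators along intertwiners -/

section Transport

open ContinuousLinearMap

variable {H : Type u} [NormedAddCommGroup H] [InnerProductSpace ℂ H]
  {K : Type v} [NormedAddCommGroup K] [InnerProductSpace ℂ K]

/-- The evaluation map `Y ⊗ ξ ↦ Y ξ`. -/
def evalTensor (I : Submodule ℂ (H →L[ℂ] K)) : I ⊗[ℂ] H →ₗ[ℂ] K :=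
  TensorProduct.lift (ContinuousLinearMap.coeLM ℂ ∘ₗ I.subtype)

@[simp]
theorem evalTensor_tmul (I : Submodule ℂ (H →L[ℂ] K)) (Y : I) (ξ : H) :
    evalTensor I (Y ⊗ₜ ξ) = (Y : H →L[ℂ] K) ξ := rfl

/-- The action of an operator of `H` on the second factor of `I ⊗ H`. -/
abbrev actRight (I : Submodule ℂ (H →L[ℂ] K)) (S : H →L[ℂ] H) : I ⊗[ℂ] H →ₗ[ℂ] I ⊗[ℂ] H :=
  LinearMap.lTensor I (S : H →ₗ[ℂ] H)

theorem Commute.clm_apply {S T : H →L[ℂ] H} (h : Commute S T) (x : H) : S (T x) = T (S x) :=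
  DFunLike.congr_fun h.eq x

variable [CompleteSpace H] [CompleteSpace K]

/-- An operator may be prescribed on the range of `e`, as long as the prescription is bounded;
extend it by zero on the orthogonal complement. -/
theorem exists_clm_of_norm_le {E : Type*} [AddCommGroup E] [Module ℂ E] (e : E →ₗ[ℂ] H)
    (f : E →ₗ[ℂ] K) (C : ℝ) (h : ∀ x, ‖f x‖ ≤ C * ‖e x‖) :
    ∃ T : H →L[ℂ] K, (∀ x, T (e x) = f x) ∧ ∀ v, (∀ x, ⟪e x, v⟫_ℂ = 0) → T v = 0 := by
  let R : Submodule ℂ H := (LinearMap.range e).topologicalClosure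
  have hR (x : E) : e x ∈ R := Submodule.le_topologicalClosure _ ⟨x, rfl⟩
  let e' : E →ₗ[ℂ] R := e.codRestrict R hR
  have : CompleteSpace R := (Submodule.isClosed_topologicalClosure _).completeSpace_coe
  have hd : DenseRange e' := by
    intro y
    rw [closure_subtype, ← Set.range_comp]
    exact y.2
  refine ⟨f.extendOfNorm e' ∘L R.orthogonalProjectionOnto, fun x => ?_, fun v hv => ?_⟩
  · have h1 : R.orthogonalProjectionOnto (e x) = e' x :=
      Submodule.orthogonalProjectionOnto_mem_subspace_eq_self (e' x)
    rw [comp_apply, h1]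
    exact LinearMap.extendOfNorm_eq hd ⟨C, h⟩ x
  · have h1 : v ∈ Rᗮ := by
      rw [Submodule.orthogonal_closure]
      rintro _ ⟨x, rfl⟩
      exact hv x
    rw [comp_apply, Submodule.orthogonalProjectionOnto_apply_of_mem_orthogonal h1, map_zero]

/-- `‖S‖² - S* S` is of the form `D* D`, where `D` commutes with whatever commutes with `S` and
`S*`. -/
theorem exists_star_mul_self_eq_norm_sq_sub (S : H →L[ℂ] H) :
    ∃ D : H →L[ℂ] H, star D * D = algebraMap ℝ (H →L[ℂ] H) (‖S‖ ^ 2) - star S * S ∧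
      ∀ Z, Commute Z S → Commute Z (star S) → Commute Z D := by
  have h0 : 0 ≤ algebraMap ℝ (H →L[ℂ] H) (‖S‖ ^ 2) - star S * S :=
    sub_nonneg.2 CStarAlgebra.star_mul_le_algebraMap_norm_sq
  refine ⟨CFC.sqrt (algebraMap ℝ (H →L[ℂ] H) (‖S‖ ^ 2) - star S * S), ?_, fun Z h1 h2 => ?_⟩
  · rw [(CFC.sqrt_nonneg _).isSelfAdjoint.star_eq, CFC.sqrt_mul_sqrt_self _ h0]
  · have h3 : Commute (algebraMap ℝ (H →L[ℂ] H) (‖S‖ ^ 2) - star S * S) Z :=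
      (Algebra.commute_algebraMap_left _ _).sub_left (h2.mul_right h1).symm
    exact (h3.cfcₙ_nnreal _).symm

theorem inner_evalTensor_actRight (I : Submodule ℂ (H →L[ℂ] K)) (S : H →L[ℂ] H)
    (hS : ∀ Y ∈ I, ∀ Y' ∈ I, Commute (adjoint Y ∘L Y') (star S)) (z w : I ⊗[ℂ] H) :
    ⟪evalTensor I (actRight I S z), evalTensor I w⟫_ℂ =
      ⟪evalTensor I z, evalTensor I (actRight I (star S) w)⟫_ℂ := by
  induction z with
  | zero => simp
  | add z z' hz hz' => simp only [map_add, inner_add_left, hz, hz']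
  | tmul Y ξ =>
    induction w with
    | zero => simp
    | add w w' hw hw' => simp only [map_add, inner_add_right, hw, hw']
    | tmul Y' ξ' =>
      have h := congrArg (inner ℂ ξ) ((hS Y Y.2 Y' Y'.2).clm_apply ξ')
      simp only [comp_apply, star_eq_adjoint, adjoint_inner_right] at h
      simpa [star_eq_adjoint] using h.symm

theorem norm_evalTensor_actRight_le (I : Submodule ℂ (H →L[ℂ] K)) (S : H →L[ℂ] H)
    (hS : ∀ Y ∈ I, ∀ Y' ∈ I, Commute (adjoint Y ∘L Y') S) (z : I ⊗[ℂ] H) :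
    ‖evalTensor I (actRight I S z)‖ ≤ ‖S‖ * ‖evalTensor I z‖ := by
  have hS' : ∀ Y ∈ I, ∀ Y' ∈ I, Commute (adjoint Y ∘L Y') (star S) := fun Y hY Y' hY' => by
    have h := (hS Y' hY' Y hY).star_star
    rwa [star_eq_adjoint, adjoint_comp, adjoint_adjoint] at h
  obtain ⟨D, hD, hDc⟩ := exists_star_mul_self_eq_norm_sq_sub S
  have hD' : ∀ Y ∈ I, ∀ Y' ∈ I, Commute (adjoint Y ∘L Y') (star D) := fun Y hY Y' hY' => by
    have h := (hDc _ (hS Y' hY' Y hY) (hS' Y' hY' Y hY)).star_star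
    rwa [star_eq_adjoint, adjoint_comp, adjoint_adjoint] at h
  have hmul (T T' : H →L[ℂ] H) : actRight I T (actRight I T' z) = actRight I (T * T') z := by
    have : ((T * T' : H →L[ℂ] H) : H →ₗ[ℂ] H) = (T : H →ₗ[ℂ] H) ∘ₗ (T' : H →ₗ[ℂ] H) := rfl
    rw [actRight, actRight, actRight, this, LinearMap.lTensor_comp, LinearMap.comp_apply]
  -- the difference of the squares of the two sides is `‖(1 ⊗ D) z‖²`
  have key : ⟪evalTensor I (actRight I S z), evalTensor I (actRight I S z)⟫_ℂ +
      ⟪evalTensor I (actRight I D z), evalTensor I (actRight I D z)⟫_ℂ =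
      ((‖S‖ ^ 2 : ℝ) : ℂ) * ⟪evalTensor I z, evalTensor I z⟫_ℂ := by
    rw [inner_evalTensor_actRight I S hS', inner_evalTensor_actRight I D hD', hmul, hmul, hD,
      ← inner_add_right, ← map_add, ← LinearMap.add_apply, ← LinearMap.lTensor_add, ← inner_smul_right,
      ← map_smul]
    have h1 : ((star S * S : H →L[ℂ] H) : H →ₗ[ℂ] H) +
        ((algebraMap ℝ (H →L[ℂ] H) (‖S‖ ^ 2) - star S * S : H →L[ℂ] H) : H →ₗ[ℂ] H) =
        ((‖S‖ ^ 2 : ℝ) : ℂ) • LinearMap.id := by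
      ext ξ
      simp only [Algebra.algebraMap_eq_smul_one, LinearMap.add_apply, coe_coe, sub_apply, smul_apply,
        one_apply_eq_self, add_sub_cancel, LinearMap.smul_apply, LinearMap.id_apply, Complex.coe_smul]
    rw [h1, LinearMap.lTensor_smul, LinearMap.lTensor_id, LinearMap.smul_apply, LinearMap.id_apply]
  have hn (x : K) : ⟪x, x⟫_ℂ = ((‖x‖ ^ 2 : ℝ) : ℂ) := by
    rw [inner_self_eq_norm_sq_to_K]
    norm_cast
  rw [hn, hn, hn] at key
  have key' : ‖evalTensor I (actRight I S z)‖ ^ 2 + ‖evalTensor I (actRight I D z)‖ ^ 2 =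
      ‖S‖ ^ 2 * ‖evalTensor I z‖ ^ 2 := by
    exact_mod_cast key
  refine abs_le_of_sq_le_sq' ?_ (by positivity) |>.2
  have := sq_nonneg ‖evalTensor I (actRight I D z)‖
  rw [mul_pow]
  linarith

/-- If `S` commutes with all `Y* Y'`, for `Y` and `Y'` in a space `I` of operators from `H` to `K`,
then the map `Y ξ ↦ Y S ξ` defines an operator of `K`, made zero on the complement of `I H`. -/
theorem exists_transport (I : Submodule ℂ (H →L[ℂ] K)) (S : H →L[ℂ] H)
    (hS : ∀ Y ∈ I, ∀ Y' ∈ I, Commute (adjoint Y ∘L Y') S) :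
    ∃ T : K →L[ℂ] K, (∀ Y ∈ I, ∀ ξ, T (Y ξ) = Y (S ξ)) ∧
      ∀ v, (∀ Y ∈ I, adjoint Y v = 0) → T v = 0 := by
  obtain ⟨T, h1, h2⟩ := exists_clm_of_norm_le (E := I ⊗[ℂ] H) (evalTensor I)
    (evalTensor I ∘ₗ actRight I S) ‖S‖
    (norm_evalTensor_actRight_le I S hS)
  refine ⟨T, fun Y hY ξ => h1 (⟨Y, hY⟩ ⊗ₜ ξ), fun v hv => h2 v fun z => ?_⟩
  induction z with
  | zero => simp
  | add z z' hz hz' => simp only [map_add, inner_add_left, hz, hz', add_zero]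
  | tmul Y ξ => rw [evalTensor_tmul, ← adjoint_inner_right, hv Y Y.2, inner_zero_right]

/-- Operators are equal if they agree on the ranges of a set `I` of operators and on the orthogonal
complement of these ranges. -/
theorem eq_of_eq_on_ranges_of_eq_on_complement {I : Set (H →L[ℂ] K)}
    {F : Type*} [NormedAddCommGroup F] [InnerProductSpace ℂ F]
    {T T' : K →L[ℂ] F} (h : ∀ Y ∈ I, ∀ ξ, T (Y ξ) = T' (Y ξ))
    (h' : ∀ v, (∀ Y ∈ I, adjoint Y v = 0) → T v = T' v) : T = T' := by
  let P : Submodule ℂ K := LinearMap.ker (T - T' : K →L[ℂ] F).toLinearMap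
  have hmem {v : K} : v ∈ P ↔ T v = T' v := sub_eq_zero
  have : CompleteSpace P := (T - T').isClosed_ker.completeSpace_coe
  have hP : Pᗮ = ⊥ := by
    refine eq_bot_iff.2 fun v hv => ?_
    have hvP : v ∈ P := hmem.2 <| h' v fun Y hY => ext_inner_left ℂ fun ξ => by
      rw [adjoint_inner_right, inner_zero_right]
      exact (Submodule.mem_orthogonal _ _).1 hv _ (hmem.2 (h Y hY ξ))
    exact (Submodule.mem_bot ℂ).2 (inner_self_eq_zero.1 ((Submodule.mem_orthogonal _ _).1 hv v hvP))
  refine ext fun v => hmem.1 ?_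
  rw [Submodule.orthogonal_eq_bot_iff.1 hP]
  trivial

theorem eq_of_total {I : Set (H →L[ℂ] K)} (hI : ∀ v, (∀ Y ∈ I, adjoint Y v = 0) → v = 0)
    {F : Type*} [NormedAddCommGroup F] [InnerProductSpace ℂ F]
    {T T' : K →L[ℂ] F} (h : ∀ Y ∈ I, ∀ ξ, T (Y ξ) = T' (Y ξ)) : T = T' :=
  eq_of_eq_on_ranges_of_eq_on_complement h fun v hv => by rw [hI v hv, map_zero, map_zero]

/-- A space `I` of operators from `H` to `K` with total range carries *-algebras of operators of
`H` that commute with all `Y* Y'`, `Y, Y' ∈ I`, to *-algebras of operators of `K`. -/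
theorem exists_inducedRep (I : Submodule ℂ (H →L[ℂ] K))
    (hI : ∀ v, (∀ Y ∈ I, adjoint Y v = 0) → v = 0) (M : StarSubalgebra ℂ (H →L[ℂ] H))
    (hM : ∀ S ∈ M, ∀ Y ∈ I, ∀ Y' ∈ I, Commute (adjoint Y ∘L Y') S) :
    ∃ Θ : M →⋆ₐ[ℂ] (K →L[ℂ] K), ∀ S : M, ∀ Y ∈ I, ∀ ξ, Θ S (Y ξ) = Y ((S : H →L[ℂ] H) ξ) := by
  choose Θ hΘ using fun S : M => exists_transport I S (hM S S.2)
  replace hΘ := fun S => (hΘ S).1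
  have hu {S : M} {T : K →L[ℂ] K} (h : ∀ Y ∈ I, ∀ ξ, T (Y ξ) = Y ((S : H →L[ℂ] H) ξ)) :
      Θ S = T := eq_of_total (I := I) hI fun Y hY ξ => (hΘ S Y hY ξ).trans (h Y hY ξ).symm
  refine ⟨{
    toFun := Θ
    map_one' := hu fun Y hY ξ => rfl
    map_mul' := fun S S' => hu fun Y hY ξ => by
      change Θ S (Θ S' (Y ξ)) = _
      rw [hΘ S' Y hY, hΘ S Y hY]
      rfl
    map_zero' := hu fun Y hY ξ => (map_zero Y).symm
    map_add' := fun S S' => hu fun Y hY ξ => by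
      rw [add_apply, hΘ S Y hY, hΘ S' Y hY, ← map_add]
      rfl
    commutes' := fun c => hu fun Y hY ξ => by
      change c • Y ξ = Y (c • ξ)
      rw [map_smul]
    map_star' := fun S => hu fun Y hY ξ => ?_ }, hΘ⟩
  rw [← sub_eq_zero]
  refine hI _ fun Y' hY' => ext_inner_left ℂ fun ξ' => ?_
  have h := congrArg (inner ℂ ξ') ((hM _ (star_mem S.2) Y' hY' Y hY).clm_apply ξ)
  simp only [comp_apply, star_eq_adjoint, adjoint_inner_right] at h
  rw [adjoint_inner_right, inner_sub_right, star_eq_adjoint, adjoint_inner_right, hΘ S Y' hY',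
    StarMemClass.coe_star, star_eq_adjoint, h, sub_self, inner_zero_right]

end Transport

/-! ### The ultraweak topology and the bicommutant theorem -/

section Bicommutant

open ContinuousLinearMap

variable {H : Type u} [NormedAddCommGroup H] [InnerProductSpace ℂ H]

theorem functional_eq_inner_ampl (x y : lp (fun _ : ℕ => H) 2) (T : H →L[ℂ] H) :
    ∑' n, ⟪x n, T (y n)⟫_ℂ = ⟪x, ampl T y⟫_ℂ :=
  (lp.inner_eq_tsum x (ampl T y)).symm

theorem continuous_ultraweak_inner (ξ η : H) :
    Continuous[ultraweak H, _] fun T : H →L[ℂ] H => ⟪ξ, T η⟫_ℂ := by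
  convert! continuous_functional (lp.single 2 0 ξ) (lp.single 2 0 η) using 2 with T
  rw [functional_eq_inner_ampl, lp.inner_single_left, ampl, diagOp_apply, lp.single_apply_self]

theorem t2Space_ultraweak : @T2Space (H →L[ℂ] H) (ultraweak H) := by
  let _ := ultraweak H
  refine ⟨fun S T hST => ?_⟩
  obtain ⟨ξ, η, h⟩ : ∃ ξ η : H, ⟪ξ, S η⟫_ℂ ≠ ⟪ξ, T η⟫_ℂ := by
    by_contra! h
    exact hST (ext fun η => ext_inner_left ℂ fun ξ => h ξ η)
  exact separated_by_continuous (continuous_ultraweak_inner ξ η) h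

theorem ultraweak_eq_induced : ultraweak H = TopologicalSpace.induced
    (fun (T : H →L[ℂ] H) (p : lp (fun _ : ℕ => H) 2 × lp (fun _ : ℕ => H) 2) =>
      ∑' n, ⟪p.1 n, T (p.2 n)⟫_ℂ) Pi.topologicalSpace := by
  rw [ultraweak, Pi.topologicalSpace, induced_iInf]
  simp only [induced_compose]
  rfl

variable [CompleteSpace H]

theorem mem_bicommutant {s : Set (H →L[ℂ] H)} (hs : ∀ g ∈ s, star g ∈ s) {T : H →L[ℂ] H} :
    T ∈ (bicommutant s).toStarSubalgebra ↔ ∀ Z, (∀ g ∈ s, Commute g Z) → Commute Z T := by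
  have h1 (Z : H →L[ℂ] H) : Z ∈ StarSubalgebra.centralizer ℂ s ↔ ∀ g ∈ s, Commute g Z := by
    rw [StarSubalgebra.mem_centralizer_iff]
    exact ⟨fun h g hg => (h g hg).1, fun h g hg => ⟨h g hg, h (star g) (hs g hg)⟩⟩
  change T ∈ StarSubalgebra.centralizer ℂ _ ↔ _
  rw [StarSubalgebra.mem_centralizer_iff]
  exact ⟨fun h Z hZ => (h Z ((h1 Z).2 hZ)).1,
    fun h Z hZ => ⟨h Z ((h1 Z).1 hZ), h _ ((h1 _).1 (star_mem hZ))⟩⟩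

theorem subset_bicommutant (s : Set (H →L[ℂ] H)) : s ⊆ (bicommutant s).toStarSubalgebra :=
  fun T hT => (StarSubalgebra.mem_centralizer_iff ℂ).2 fun _ hg =>
    ⟨(((StarSubalgebra.mem_centralizer_iff ℂ).1 hg T hT).1).symm,
      (((StarSubalgebra.mem_centralizer_iff ℂ).1 (star_mem hg) T hT).1).symm⟩

theorem isClosed_bicommutant (s : Set (H →L[ℂ] H)) :
    @IsClosed _ (ultraweak H) ((bicommutant s).toStarSubalgebra : Set (H →L[ℂ] H)) := by
  let _ := ultraweak H
  have : IsSemitopologicalSemiring (H →L[ℂ] H) := isSemitopologicalSemiring_ultraweak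
  have : T2Space (H →L[ℂ] H) := t2Space_ultraweak
  change IsClosed (StarSubalgebra.centralizer ℂ
    (StarSubalgebra.centralizer ℂ s : Set (H →L[ℂ] H)) : Set (H →L[ℂ] H))
  rw [StarSubalgebra.coe_centralizer]
  exact Set.isClosed_centralizer _

/-- The amplification of operators to the Hilbert sum of copies of `H` indexed by `κ`. -/
def amplify (H : Type u) [NormedAddCommGroup H] [InnerProductSpace ℂ H] [CompleteSpace H]
    (κ : Type w) :
    (H →L[ℂ] H) →⋆ₙₐ[ℂ] (lp (fun _ : κ => H) 2 →L[ℂ] lp (fun _ : κ => H) 2) :=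
  sumRep fun _ => NonUnitalStarAlgHom.id ℂ _

@[simp]
theorem amplify_apply (κ : Type w) (T : H →L[ℂ] H) (f : lp (fun _ : κ => H) 2) (i : κ) :
    amplify H κ T f i = T (f i) := rfl

theorem amplify_single {κ : Type w} [DecidableEq κ] (T : H →L[ℂ] H) (j : κ) (v : H) :
    amplify H κ T (lp.single 2 j v) = lp.single 2 j (T v) := by
  ext i
  by_cases h : i = j
  · subst h
    simp
  · simp [h]

/-- An operator commuting with an amplified set has matrix entries that commute with the set. -/
theorem commute_amplify (κ : Type w) {s : Set (H →L[ℂ] H)} {T : H →L[ℂ] H}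
    (hT : ∀ Z, (∀ g ∈ s, Commute g Z) → Commute Z T)
    (Z : lp (fun _ : κ => H) 2 →L[ℂ] lp (fun _ : κ => H) 2)
    (hZ : ∀ g ∈ s, Commute (amplify H κ g) Z) : Commute Z (amplify H κ T) := by
  classical
  let E (i j : κ) : H →L[ℂ] H :=
    lp.evalCLM ℂ (fun _ => H) 2 i ∘L Z ∘L lp.singleContinuousLinearMap ℂ (fun _ => H) 2 j
  have hE (i j : κ) (v : H) : E i j v = Z (lp.single 2 j v) i := rfl
  have hET (i j : κ) : Commute (E i j) T := by
    refine hT _ fun g hg => ext fun v => ?_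
    change g (E i j v) = E i j (g v)
    rw [hE, hE, ← amplify_single, ← (hZ g hg).clm_apply, amplify_apply]
  refine lp.ext_continuousLinearMap (by simp) fun j => ext fun v => lp.ext (funext fun i => ?_)
  change Z (amplify H κ T (lp.single 2 j v)) i = amplify H κ T (Z (lp.single 2 j v)) i
  rw [amplify_single, amplify_apply, ← hE, ← hE]
  exact (hET i j).clm_apply v

/-- A set of operators, in practice a *-algebra, is nondegenerate if only zero is annihilated by all
of it. -/
def IsNondegenerate (S : Set (H →L[ℂ] H)) : Prop := ∀ x, (∀ s ∈ S, s x = 0) → x = 0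

theorem IsNondegenerate.amplify {S : Set (H →L[ℂ] H)} (hS : IsNondegenerate S) (κ : Type w) :
    IsNondegenerate (amplify H κ '' S) := by
  refine fun x hx => lp.ext (funext fun i => hS _ fun s hs => ?_)
  rw [← amplify_apply, hx _ ⟨s, hs, rfl⟩]
  rfl

/-- An element of the bicommutant of a nondegenerate *-algebra `S` maps each vector `y` into the
closure of `S y`: the projection onto this closure commutes with `S`, and it fixes `y`. -/
theorem apply_mem_closure_of_commute (S : NonUnitalStarSubalgebra ℂ (H →L[ℂ] H))
    (hS : IsNondegenerate (S : Set (H →L[ℂ] H))) {T : H →L[ℂ] H}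
    (hT : ∀ Z, (∀ g ∈ S, Commute g Z) → Commute Z T) (y : H) :
    T y ∈ closure ((fun s : H →L[ℂ] H => s y) '' S) := by
  let R : Submodule ℂ H :=
    (S.toSubmodule.map (ContinuousLinearMap.apply ℂ H y : (H →L[ℂ] H) →ₗ[ℂ] H)).topologicalClosure
  have hRc : (R : Set H) = closure ((fun s : H →L[ℂ] H => s y) '' S) := by
    rw [Submodule.topologicalClosure_coe]
    rfl
  have : CompleteSpace R := (Submodule.isClosed_topologicalClosure _).completeSpace_coe
  have hR : ∀ s ∈ S, ∀ x ∈ R, s x ∈ R := by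
    intro s hs x hx
    rw [← SetLike.mem_coe, hRc] at hx ⊢
    refine map_mem_closure s.continuous hx ?_
    rintro _ ⟨t, ht, rfl⟩
    exact ⟨s * t, mul_mem hs ht, rfl⟩
  have hP : ∀ s ∈ S, Commute s R.starProjection := by
    refine fun s hs => ext fun x => ?_
    change s (R.starProjection x) = R.starProjection (s x)
    refine (Submodule.eq_starProjection_of_mem_of_inner_eq_zero
      (hR s hs _ (R.starProjection_apply_mem x)) fun w hw => ?_).symm
    rw [← map_sub, ← adjoint_inner_right]
    exact R.starProjection_inner_eq_zero _ _ (hR _ (star_mem hs) w hw)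
  have hy : y ∈ R := by
    rw [← R.starProjection_eq_self_iff, eq_comm, ← sub_eq_zero]
    refine hS _ fun s hs => ?_
    rw [map_sub, (hP s hs).clm_apply, sub_eq_zero, eq_comm, R.starProjection_eq_self_iff,
      ← SetLike.mem_coe, hRc]
    exact subset_closure ⟨s, hs, rfl⟩
  rw [← hRc, SetLike.mem_coe, ← R.starProjection_eq_self_iff, (hT _ hP).clm_apply,
    R.starProjection_eq_self_iff.2 hy]

/-- The density part of von Neumann's bicommutant theorem. -/
theorem bicommutant_subset_closure (S : NonUnitalStarSubalgebra ℂ (H →L[ℂ] H))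
    (hS : IsNondegenerate (S : Set (H →L[ℂ] H))) :
    ((bicommutant (S : Set (H →L[ℂ] H))).toStarSubalgebra : Set (H →L[ℂ] H)) ⊆
      @closure _ (ultraweak H) (S : Set (H →L[ℂ] H)) := by
  intro T hT
  replace hT := (mem_bicommutant fun g hg => star_mem hg).1 hT
  rw [ultraweak_eq_induced, closure_induced, mem_closure_iff]
  intro o ho hTo
  obtain ⟨J, V, hV, hVo⟩ := isOpen_pi_iff.1 ho _ hTo
  -- finitely many functionals are vector functionals of one amplification
  let S' : NonUnitalStarSubalgebra ℂ _ := (S.map (amplify H ℕ)).map (amplify (lp (fun _ : ℕ => H) 2) J)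
  have hS' : IsNondegenerate (S' : Set (lp (fun _ : J => lp (fun _ : ℕ => H) 2) 2 →L[ℂ] _)) :=
    (hS.amplify ℕ).amplify J
  have hT' : ∀ Z, (∀ g ∈ S', Commute g Z) → Commute Z (amplify (lp (fun _ : ℕ => H) 2) J (amplify H ℕ T)) := by
    intro Z hZ
    refine commute_amplify J (s := amplify H ℕ '' S) (fun Z' hZ' => ?_) Z
      fun g hg => hZ _ ⟨g, hg, rfl⟩
    exact commute_amplify ℕ hT Z' fun g hg => hZ' _ ⟨g, hg, rfl⟩
  let y : lp (fun _ : J => lp (fun _ : ℕ => H) 2) 2 := ⟨fun p => p.1.2, Memℓp.all _⟩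
  have hy := apply_mem_closure_of_commute S' hS' hT' y
  have hopen : IsOpen {z : lp (fun _ : J => lp (fun _ : ℕ => H) 2) 2 |
      ∀ p : J, ⟪p.1.1, z p⟫_ℂ ∈ V p.1} := by
    simp only [Set.ofPred_forall]
    refine isOpen_iInter_of_finite fun p => ?_
    exact (hV p.1 p.2).1.preimage
      (continuous_const.inner (lp.evalCLM ℂ (fun _ : J => lp (fun _ : ℕ => H) 2) 2 p).continuous)
  obtain ⟨_, h1, _, ⟨_, ⟨s, hs, rfl⟩, rfl⟩, rfl⟩ := mem_closure_iff.1 hy _ hopen fun p => by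
    have := (hV p.1 p.2).2
    rw [functional_eq_inner_ampl] at this
    exact this
  refine ⟨_, hVo fun p hp => ?_, s, hs, rfl⟩
  change ∑' n, ⟪p.1 n, s (p.2 n)⟫_ℂ ∈ V p
  rw [functional_eq_inner_ampl]
  exact h1 ⟨p, hp⟩

end Bicommutant

/-! ### Intertwiners and normal extensions of representations -/

section Intertwiners

open ContinuousLinearMap

variable {A : Type*} [NonUnitalCStarAlgebra A]
  {H : Type u} [NormedAddCommGroup H] [InnerProductSpace ℂ H] [CompleteSpace H]
  {K : Type v} [NormedAddCommGroup K] [InnerProductSpace ℂ K] [CompleteSpace K]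

/-- The operators that intertwine two representations. -/
def intertwiners (π : A →⋆ₙₐ[ℂ] (H →L[ℂ] H)) (ρ : A →⋆ₙₐ[ℂ] (K →L[ℂ] K)) :
    Submodule ℂ (H →L[ℂ] K) where
  carrier := {Y | ∀ a ξ, Y (π a ξ) = ρ a (Y ξ)}
  zero_mem' := fun a ξ => (map_zero (ρ a)).symm
  add_mem' := fun {Y Y'} h h' a ξ => by simp only [add_apply, h a ξ, h' a ξ, map_add]
  smul_mem' := fun c Y h a ξ => by simp only [smul_apply, h a ξ, map_smul]

variable {π : A →⋆ₙₐ[ℂ] (H →L[ℂ] H)} {ρ : A →⋆ₙₐ[ℂ] (K →L[ℂ] K)}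

theorem adjoint_apply_map (a : A) (x y : H) : ⟪π a x, y⟫_ℂ = ⟪x, π (star a) y⟫_ℂ := by
  rw [map_star, star_eq_adjoint, adjoint_inner_right]

theorem adjoint_mem_intertwiners {Y : H →L[ℂ] K} (hY : Y ∈ intertwiners π ρ) :
    adjoint Y ∈ intertwiners ρ π := by
  refine fun a ξ => ext_inner_right ℂ fun η => ?_
  rw [adjoint_inner_left, adjoint_apply_map, adjoint_apply_map, adjoint_inner_left, hY]

theorem commute_adjoint_comp {Y Y' : H →L[ℂ] K} (hY : Y ∈ intertwiners π ρ)
    (hY' : Y' ∈ intertwiners π ρ) (a : A) : Commute (π a) (adjoint Y ∘L Y') := by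
  refine ext fun ξ => ?_
  change π a (adjoint Y (Y' ξ)) = adjoint Y (Y' (π a ξ))
  rw [hY', adjoint_mem_intertwiners hY]

theorem mem_bicommutant_range {T : H →L[ℂ] H} :
    T ∈ (bicommutant (Set.range π)).toStarSubalgebra ↔
      ∀ Z, (∀ a, Commute (π a) Z) → Commute Z T := by
  rw [mem_bicommutant]
  · simp
  · rintro _ ⟨a, rfl⟩
    exact ⟨star a, map_star π a⟩

/-- Every vector of `ρ` is reached from `π` by a contractive intertwiner without loss of norm. -/
def IsQuasiContained (ρ : A →⋆ₙₐ[ℂ] (K →L[ℂ] K)) (π : A →⋆ₙₐ[ℂ] (H →L[ℂ] H)) : Prop :=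
  ∀ y : K, ∃ Y ∈ intertwiners π ρ, ‖Y‖ ≤ 1 ∧ ∃ η, ‖η‖ ≤ ‖y‖ ∧ Y η = y

theorem IsQuasiContained.total (h : IsQuasiContained ρ π) (v : K)
    (hv : ∀ Y ∈ intertwiners π ρ, adjoint Y v = 0) : v = 0 := by
  obtain ⟨Y, hY, -, η, -, hη⟩ := h v
  rw [← inner_self_eq_zero (𝕜 := ℂ)]
  nth_rw 1 [← hη]
  rw [← adjoint_inner_right, hv Y hY, inner_zero_right]

/-- If `ρ` is quasi-contained in `π`, then `π(a) ↦ ρ(a)` extends to a normal *-homomorphism of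
`π(A)''` onto `ρ(A)''`. Both the homomorphism and preimages under it are obtained by transport along
intertwiners. -/
theorem IsQuasiContained.exists_normal_extension (h : IsQuasiContained ρ π) :
    ∃ Θ : (bicommutant (Set.range π)).toStarSubalgebra →⋆ₐ[ℂ] (K →L[ℂ] K),
      Continuous[weakStar _, ultraweak K] Θ ∧
      (∀ a, Θ ⟨π a, subset_bicommutant _ ⟨a, rfl⟩⟩ = ρ a) ∧
      Set.range Θ = (bicommutant (Set.range ρ)).toStarSubalgebra := by
  obtain ⟨Θ, hΘ⟩ := exists_inducedRep (intertwiners π ρ) h.total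
    (bicommutant (Set.range π)).toStarSubalgebra fun S hS Y hY Y' hY' =>
      mem_bicommutant_range.1 hS _ (commute_adjoint_comp hY hY')
  have hu {S : (bicommutant (Set.range π)).toStarSubalgebra} {T : K →L[ℂ] K}
      (hT : ∀ Y ∈ intertwiners π ρ, ∀ ξ, T (Y ξ) = Y ((S : H →L[ℂ] H) ξ)) : Θ S = T :=
    eq_of_total (I := intertwiners π ρ) h.total fun Y hY ξ =>
      (hΘ S Y hY ξ).trans (hT Y hY ξ).symm
  refine ⟨Θ, ?_, fun a => hu fun Y hY ξ => (hY a ξ).symm, Set.Subset.antisymm ?_ ?_⟩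
  · let _ := ultraweak H
    refine continuous_ultraweak_iff.2 fun x y => ?_
    choose Y hY hY1 η hη hYη using fun n => h (y n)
    -- move the functional given by `x` and `y` to `H`
    let x' : lp (fun _ : ℕ => H) 2 := ⟨fun n => adjoint (Y n) (x n), (lp.memℓp x).mono' fun n => by
      refine ((adjoint (Y n)).le_opNorm _).trans (mul_le_of_le_one_left (norm_nonneg _) ?_)
      rw [LinearIsometryEquiv.norm_map]
      exact hY1 n⟩
    let y' : lp (fun _ : ℕ => H) 2 := ⟨η, (lp.memℓp y).mono' hη⟩
    have he (S : (bicommutant (Set.range π)).toStarSubalgebra) :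
        ∑' n, ⟪x n, Θ S (y n)⟫_ℂ = ∑' n, ⟪x' n, (S : H →L[ℂ] H) (y' n)⟫_ℂ := by
      refine tsum_congr fun n => ?_
      change _ = ⟪adjoint (Y n) (x n), (S : H →L[ℂ] H) (η n)⟫_ℂ
      rw [adjoint_inner_left, ← hΘ S _ (hY n), hYη]
    simp only [he]
    exact (continuous_functional x' y').comp continuous_induced_dom
  · rintro _ ⟨S, rfl⟩
    refine mem_bicommutant_range.2 fun Z hZ =>
      eq_of_total (I := (intertwiners π ρ : Set (H →L[ℂ] K))) h.total fun Y hY ξ => ?_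
    have hZY : Z ∘L Y ∈ intertwiners π ρ := fun a ξ => by
      rw [comp_apply, comp_apply, hY, (hZ a).clm_apply]
    change Z (Θ S (Y ξ)) = Θ S (Z (Y ξ))
    rw [hΘ S Y hY]
    exact (hΘ S _ hZY ξ).symm
  · intro T hT
    replace hT := mem_bicommutant_range.1 hT
    obtain ⟨S, hS1, hS2⟩ := exists_transport (intertwiners ρ π) T fun X hX X' hX' =>
      hT _ (commute_adjoint_comp hX hX')
    have hS : S ∈ (bicommutant (Set.range π)).toStarSubalgebra := by
      refine mem_bicommutant_range.2 fun Z hZ => ?_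
      have hZ' (a : A) : Commute (π a) (adjoint Z) := by
        have := (hZ (star a)).star_star
        rwa [← map_star, star_star, star_eq_adjoint] at this
      refine eq_of_eq_on_ranges_of_eq_on_complement
        (I := (intertwiners ρ π : Set (K →L[ℂ] H)))
        (fun X hX ξ => ?_) fun v hv => ?_
      · have hZX : Z ∘L X ∈ intertwiners ρ π := fun a ξ => by
          rw [comp_apply, comp_apply, hX, (hZ a).clm_apply]
        change Z (S (X ξ)) = S (Z (X ξ))
        rw [hS1 X hX]
        exact (hS1 _ hZX ξ).symm
      · change Z (S v) = S (Z v)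
        rw [hS2 v hv, map_zero, hS2]
        intro X hX
        have hZX : adjoint Z ∘L X ∈ intertwiners ρ π := fun a ξ => by
          rw [comp_apply, comp_apply, hX, (hZ' a).clm_apply]
        have := hv _ hZX
        rwa [adjoint_comp, adjoint_adjoint] at this
    refine ⟨⟨S, hS⟩, hu fun Y hY ξ => ?_⟩
    have hTY : T ∘L Y = Y ∘L S := by
      refine eq_of_eq_on_ranges_of_eq_on_complement
        (I := (intertwiners ρ π : Set (K →L[ℂ] H)))
        (fun X hX ξ => ?_) fun v hv => ?_
      · have hc : Commute (Y ∘L X) T := hT _ fun a => ext fun ζ => by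
          change ρ a (Y (X ζ)) = Y (X (ρ a ζ))
          rw [hX, hY]
        change T (Y (X ξ)) = Y (S (X ξ))
        rw [hS1 X hX]
        exact (hc.clm_apply ξ).symm
      · have hYv := hv _ (adjoint_mem_intertwiners hY)
        rw [adjoint_adjoint] at hYv
        rw [comp_apply, comp_apply, hS2 v hv, hYv, map_zero, map_zero]
    exact DFunLike.congr_fun hTY ξ

end Intertwiners

/-! ### The universal representation -/

section Universal

open ContinuousLinearMap Filter

attribute [local instance] CStarAlgebra.spectralOrder CStarAlgebra.spectralOrderedRing

variable {A : Type u} [NonUnitalCStarAlgebra A]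

/-- For `a ≠ 0` there is a state that does not vanish at `a* a`. -/
theorem exists_state_ne_zero {a : A} (ha : a ≠ 0) : ∃ f : CStarState A, f.1 (star a * a) ≠ 0 := by
  have hneg : -(star a * a) ∉ ProperCone.positive ℝ A := fun h => by
    have h1 : 0 ≤ -(star a * a) := h
    have h2 : star a * a = 0 := le_antisymm (neg_nonneg.1 h1) (star_mul_self_nonneg a)
    exact ha (CStarRing.star_mul_self_eq_zero_iff a |>.1 h2)
  obtain ⟨f, hf, hfa⟩ := ProperCone.hyperplane_separation_point _ hneg
  rw [map_neg, neg_lt_zero] at hfa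
  -- the hermitian complex functional that agrees with `f` on self-adjoint elements
  let g : StrongDual ℝ A := (2⁻¹ : ℝ) • (f + f ∘L (starL' ℝ : A ≃L[ℝ] A).toContinuousLinearMap)
  have hg (x : A) : g x = 2⁻¹ * (f x + f (star x)) := rfl
  let F : StrongDual ℂ A := g.extendRCLike
  have hF (x : A) : F (star x * x) = (f (star x * x) : ℂ) := by
    rw [show F (star x * x) = _ from StrongDual.extendRCLike_apply _ _, hg, hg]
    simp
    ring
  have hF0 : F (star a * a) ≠ 0 := by
    rw [hF]
    exact_mod_cast hfa.ne'
  have hFn : ‖F‖ ≠ 0 := fun h => hF0 (by rw [norm_eq_zero.1 h]; rfl)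
  refine ⟨⟨((‖F‖⁻¹ : ℝ) : ℂ) • F, ?_, fun x => ?_⟩, ?_⟩
  · rw [norm_smul, Complex.norm_real, norm_inv, norm_norm, inv_mul_cancel₀ hFn]
  · rw [smul_apply, hF, smul_eq_mul, ← Complex.ofReal_mul]
    have := hf (star x * x) (star_mul_self_nonneg x)
    exact_mod_cast (by positivity : 0 ≤ ‖F‖⁻¹ * f (star x * x))
  · rw [smul_apply, smul_eq_mul]
    exact mul_ne_zero (by simpa using hFn) hF0

theorem CStarState.norm_toPreGNS_sq (f : CStarState A) (a : A) :
    (‖f.toPositive.toPreGNS a‖ ^ 2 : ℂ) = f.1 (star a * a) := by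
  exact_mod_cast f.toPositive.preGNS_norm_sq (f.toPositive.toPreGNS a)

theorem CStarState.norm_toPreGNS_le (f : CStarState A) (a : A) :
    ‖f.toPositive.toPreGNS a‖ ≤ ‖a‖ := by
  refine abs_le_of_sq_le_sq' ?_ (norm_nonneg a) |>.2
  have h1 : ‖f.1 (star a * a)‖ = ‖f.toPositive.toPreGNS a‖ ^ 2 := by
    rw [← f.norm_toPreGNS_sq]
    simp
  rw [← h1, sq, ← CStarRing.norm_star_mul_self]
  simpa [f.2.1] using f.1.le_opNorm (star a * a)

theorem nontrivial_universalSpace [Nontrivial A] : Nontrivial (UniversalSpace A) := by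
  classical
  obtain ⟨a, ha⟩ := exists_ne (0 : A)
  obtain ⟨f, hf⟩ := exists_state_ne_zero ha
  refine ⟨lp.single 2 f (f.toPositive.toPreGNS a : f.toPositive.GNS), 0, fun h => hf ?_⟩
  rw [← norm_eq_zero, lp.norm_single (by norm_num), UniformSpace.Completion.norm_coe] at h
  rw [← f.norm_toPreGNS_sq, h]
  simp

theorem universalRep_apply (a : A) (x : UniversalSpace A) (f : CStarState A) :
    universalRep A a x f = f.toPositive.gnsNonUnitalStarAlgHom a (x f) := rfl

theorem isNondegenerate_universalRep : IsNondegenerate (Set.range (universalRep A)) := by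
  intro x hx
  refine lp.ext (funext fun f => ?_)
  have hxf (a : A) : f.toPositive.gnsNonUnitalStarAlgHom a (x f) = 0 := by
    rw [← universalRep_apply, hx _ ⟨a, rfl⟩]
    rfl
  have h (b : A) : ⟪x f, (f.toPositive.toPreGNS b : f.toPositive.GNS)⟫_ℂ = 0 := by
    let q : A →L[ℂ] f.toPositive.PreGNS :=
      LinearMap.mkContinuous f.toPositive.toPreGNS.toLinearMap 1 fun a => by
        rw [one_mul]
        exact f.norm_toPreGNS_le a
    have hq : Continuous fun a : A => ⟪x f, (q a : f.toPositive.GNS)⟫_ℂ :=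
      continuous_const.inner ((UniformSpace.Completion.continuous_coe _).comp q.continuous)
    refine tendsto_nhds_unique ((hq.tendsto b).comp
      ((CStarAlgebra.increasingApproximateUnit A).tendsto_mul_right b))
      (tendsto_const_nhds.congr fun u => ?_)
    have : (q (u * b) : f.toPositive.GNS) = f.toPositive.gnsNonUnitalStarAlgHom u (q b) := by
      rw [PositiveLinearMap.gnsNonUnitalStarAlgHom_apply_coe]
      rfl
    rw [Function.comp_apply, this, ← star_star u, ← adjoint_apply_map, hxf, inner_zero_left]
  refine (inner_self_eq_zero (𝕜 := ℂ)).1 ?_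
  refine UniformSpace.Completion.induction_on (p := fun y => ⟪x f, y⟫_ℂ = 0) (x f) ?_ h
  exact isClosed_eq (continuous_const.inner continuous_id) continuous_const

variable {L : Type w} [NormedAddCommGroup L] [InnerProductSpace ℂ L] [CompleteSpace L]

/-- Every nondegenerate representation is quasi-contained in the universal one: the cyclic
subspace generated by a unit vector is the GNS space of a multiple of its vector functional. -/
theorem isQuasiContained_universalRep (π : A →⋆ₙₐ[ℂ] (L →L[ℂ] L))
    (hπ : IsNondegenerate (Set.range π)) : IsQuasiContained π (universalRep A) := by
  classical
  intro y
  by_cases hy : y = 0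
  · exact ⟨0, zero_mem _, by simp, 0, by simp, by simp [hy]⟩
  let F : StrongDual ℂ A := LinearMap.mkContinuous
    { toFun := fun a => ⟪y, π a y⟫_ℂ
      map_add' := fun a b => by rw [map_add, add_apply, inner_add_right]
      map_smul' := fun c a => by rw [map_smul, smul_apply, inner_smul_right]; rfl } (‖y‖ ^ 2)
    fun a => by
      refine (norm_inner_le_norm _ _).trans ?_
      have := (π a).le_of_opNorm_le (NonUnitalStarAlgHom.norm_apply_le π a) y
      calc ‖y‖ * ‖π a y‖ ≤ ‖y‖ * (‖a‖ * ‖y‖) := by gcongr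
        _ = ‖y‖ ^ 2 * ‖a‖ := by ring
  have hF (a : A) : F (star a * a) = ((‖π a y‖ ^ 2 : ℝ) : ℂ) := by
    change ⟪y, π (star a * a) y⟫_ℂ = _
    rw [map_mul]
    change ⟪y, π (star a) (π a y)⟫_ℂ = _
    rw [← adjoint_apply_map, inner_self_eq_norm_sq_to_K]
    norm_cast
  have hFn : ‖F‖ ≠ 0 := fun h => hy <| hπ y <| by
    rintro _ ⟨a, rfl⟩
    have := hF a
    rw [norm_eq_zero.1 h, zero_apply, eq_comm, Complex.ofReal_eq_zero] at this
    simpa using this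
  let f : CStarState A := ⟨((‖F‖⁻¹ : ℝ) : ℂ) • F, by
    rw [norm_smul, Complex.norm_real, norm_inv, norm_norm, inv_mul_cancel₀ hFn], fun a => by
    rw [smul_apply, hF, smul_eq_mul]
    exact_mod_cast (by positivity : 0 ≤ ‖F‖⁻¹ * ‖π a y‖ ^ 2)⟩
  let e : f.toPositive.PreGNS →ₗ[ℂ] L :=
    { toFun := fun a => ((√‖F‖)⁻¹ : ℂ) • π (f.toPositive.ofPreGNS a) y
      map_add' := fun a b => by rw [map_add, map_add, add_apply, smul_add]
      map_smul' := fun c a => by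
        rw [map_smul, map_smul, smul_apply, smul_comm, RingHom.id_apply] }
  have he (a : f.toPositive.PreGNS) : ‖e a‖ = ‖a‖ := by
    refine (sq_eq_sq₀ (norm_nonneg _) (norm_nonneg _)).1 ?_
    have h1 := f.norm_toPreGNS_sq (f.toPositive.ofPreGNS a)
    have h2 : f.1 (star (f.toPositive.ofPreGNS a) * f.toPositive.ofPreGNS a) =
      ((‖F‖⁻¹ * ‖π (f.toPositive.ofPreGNS a) y‖ ^ 2 : ℝ) : ℂ) := by
      change ((‖F‖⁻¹ : ℝ) : ℂ) • F _ = _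
      rw [hF, smul_eq_mul, Complex.ofReal_mul]
    rw [h2, PositiveLinearMap.toPreGNS_ofPreGNS] at h1
    have h3 : ‖a‖ ^ 2 = ‖F‖⁻¹ * ‖π (f.toPositive.ofPreGNS a) y‖ ^ 2 := by exact_mod_cast h1
    rw [h3]
    change ‖((√‖F‖)⁻¹ : ℂ) • π (f.toPositive.ofPreGNS a) y‖ ^ 2 = _
    rw [norm_smul, mul_pow, norm_inv, Complex.norm_real, inv_pow, Real.norm_eq_abs, sq_abs,
      Real.sq_sqrt (norm_nonneg _)]
  obtain ⟨V, hV, -⟩ := exists_clm_of_norm_le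
    (UniformSpace.Completion.toComplL : f.toPositive.PreGNS →L[ℂ] f.toPositive.GNS).toLinearMap e 1
    fun a => by
      rw [one_mul, he]
      exact (UniformSpace.Completion.norm_coe a).ge
  replace hV (a : f.toPositive.PreGNS) : V (a : f.toPositive.GNS) = e a := hV a
  have hVn (z : f.toPositive.GNS) : ‖V z‖ = ‖z‖ := by
    induction z using UniformSpace.Completion.induction_on with
    | hp => exact isClosed_eq (by fun_prop) (by fun_prop)
    | ih a => rw [hV, he, UniformSpace.Completion.norm_coe]
  have hVi (a : A) (z : f.toPositive.GNS) :
      V (f.toPositive.gnsNonUnitalStarAlgHom a z) = π a (V z) := by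
    induction z using UniformSpace.Completion.induction_on with
    | hp => exact isClosed_eq (by fun_prop) (by fun_prop)
    | ih b =>
      rw [PositiveLinearMap.gnsNonUnitalStarAlgHom_apply_coe, hV, hV]
      change (_ : ℂ) • π (a * f.toPositive.ofPreGNS b) y = π a ((_ : ℂ) • _)
      rw [map_mul, map_smul]
      rfl
  have hy' : y ∈ Set.range V := by
    have h1 := apply_mem_closure_of_commute (NonUnitalStarAlgHom.range π)
      (by rwa [NonUnitalStarAlgHom.coe_range]) (T := 1) (fun Z _ => Commute.one_right Z) y
    refine closure_minimal ?_
      (AddMonoidHomClass.isometry_of_norm V hVn).isClosedEmbedding.isClosed_range h1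
    rintro _ ⟨_, ⟨a, rfl⟩, rfl⟩
    refine ⟨((√‖F‖ : ℂ) • f.toPositive.toPreGNS a : f.toPositive.PreGNS), ?_⟩
    rw [hV, map_smul]
    change (√‖F‖ : ℂ) • ((√‖F‖)⁻¹ : ℂ) • π a y = π a y
    rw [smul_smul, mul_inv_cancel₀, one_smul]
    exact_mod_cast (Real.sqrt_ne_zero (norm_nonneg _)).2 hFn
  obtain ⟨η, hη⟩ := hy'
  refine ⟨V ∘L lp.evalCLM ℂ (fun f : CStarState A => f.toPositive.GNS) 2 f, fun a ξ => hVi a _,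
    opNorm_le_bound _ zero_le_one fun x => ?_,
    lp.single (E := fun f : CStarState A => f.toPositive.GNS) 2 f η, ?_, ?_⟩
  · rw [comp_apply, hVn, one_mul]
    exact lp.norm_apply_le_norm (by norm_num) x f
  · rw [lp.norm_single (by norm_num), ← hη, hVn]
  · change V (lp.single (E := fun f : CStarState A => f.toPositive.GNS) 2 f η f) = y
    rw [lp.single_apply_self, hη]

/-- The image of `A` is weak* dense in `A**`, so that maps on `A**` are determined by their
restrictions to `A`. -/
theorem eq_of_continuous_weakStar {X : Type*} [TopologicalSpace X] [T2Space X]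
    {f g : (Enveloping A).toStarSubalgebra → X}
    (hf : Continuous[weakStar (Enveloping A).toStarSubalgebra, _] f)
    (hg : Continuous[weakStar (Enveloping A).toStarSubalgebra, _] g)
    (h : ∀ a, f (toEnveloping A a) = g (toEnveloping A a)) : f = g := by
  let _ := ultraweak (UniversalSpace A)
  have hd : DenseRange (toEnveloping A) := by
    intro S
    rw [closure_subtype, ← Set.range_comp]
    have h1 := bicommutant_subset_closure (NonUnitalStarAlgHom.range (universalRep A))
      (by rw [NonUnitalStarAlgHom.coe_range]; exact isNondegenerate_universalRep)
    rw [NonUnitalStarAlgHom.coe_range] at h1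
    exact h1 S.2
  exact hd.equalizer hf hg (funext h)

/-- Every nondegenerate representation `π` of `A` extends to a normal *-homomorphism of `A**` onto
`π(A)''`. -/
theorem exists_normal_extension (π : A →⋆ₙₐ[ℂ] (L →L[ℂ] L))
    (hπ : IsNondegenerate (Set.range π)) :
    ∃ Θ : (Enveloping A).toStarSubalgebra →⋆ₐ[ℂ] (L →L[ℂ] L),
      Continuous[weakStar _, ultraweak L] Θ ∧ (∀ a, Θ (toEnveloping A a) = π a) ∧
      Set.range Θ = (bicommutant (Set.range π)).toStarSubalgebra :=
  (isQuasiContained_universalRep π hπ).exists_normal_extension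

end Universal

/-! ### Representations of the maximal tensor product -/

section MaxRep

open ContinuousLinearMap Filter

variable {A : Type u} {B : Type v} [NonUnitalCStarAlgebra A] [NonUnitalCStarAlgebra B]

theorem MaxTensor.denseRange_of : DenseRange (MaxTensor.of : A ⊗[ℂ] B → MaxTensor A B) :=
  UniformSpace.Completion.denseRange_coe (α := AlgTensor A B)

theorem MaxTensor.of_mul (x y : A ⊗[ℂ] B) :
    (MaxTensor.of (x * y) : MaxTensor A B) = MaxTensor.of x * MaxTensor.of y :=
  MaxTensor.coe_mul' (A := A) (B := B) x y

theorem MaxTensor.of_star (x : A ⊗[ℂ] B) :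
    (MaxTensor.of (star x) : MaxTensor A B) = star (MaxTensor.of x) :=
  MaxTensor.coe_star' (A := A) (B := B) x

theorem MaxTensor.norm_of (x : A ⊗[ℂ] B) : ‖(MaxTensor.of x : MaxTensor A B)‖ = maxNorm x :=
  UniformSpace.Completion.norm_coe (E := AlgTensor A B) x

theorem maxNorm_tmul_le (a : A) (b : B) : maxNorm (a ⊗ₜ[ℂ] b) ≤ ‖a‖ * ‖b‖ :=
  maxNorm_le fun H _ _ _ p => by
    rw [p.prod_tmul]
    refine (norm_mul_le _ _).trans ?_
    gcongr
    · exact NonUnitalStarAlgHom.norm_apply_le p.left a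
    · exact NonUnitalStarAlgHom.norm_apply_le p.right b

/-- A commuting pair of representations defines a representation of the maximal tensor product. -/
theorem CommutingPair.exists_maxRep {H : Type (max u v)} [NormedAddCommGroup H]
    [InnerProductSpace ℂ H] [CompleteSpace H] (p : CommutingPair A B H) :
    ∃ π : MaxTensor A B →⋆ₙₐ[ℂ] (H →L[ℂ] H), ∀ x, π (MaxTensor.of x) = p.prod x := by
  let F₀ : AlgTensor A B →L[ℂ] (H →L[ℂ] H) :=
    LinearMap.mkContinuous (p.prod : A ⊗[ℂ] B →ₗ[ℂ] _) 1 fun x => by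
      rw [one_mul]
      exact norm_prod_le_maxNorm p x
  let F : MaxTensor A B →L[ℂ] (H →L[ℂ] H) := F₀.extend UniformSpace.Completion.toComplL
  have hF (x : AlgTensor A B) : F (x : MaxTensor A B) = p.prod x :=
    F₀.extend_eq (UniformSpace.Completion.denseRange_coe)
      (UniformSpace.Completion.isUniformInducing_coe _) x
  refine ⟨{
    toFun := F
    map_smul' := fun c x => map_smul F c x
    map_zero' := map_zero F
    map_add' := map_add F
    map_mul' := fun x y => ?_
    map_star' := fun x => ?_ }, hF⟩
  · induction x, y using UniformSpace.Completion.induction_on₂ with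
    | hp => exact isClosed_eq (by fun_prop) (by fun_prop)
    | ih x y => rw [← MaxTensor.coe_mul', hF, hF, hF]; exact p.prod_mul x y
  · induction x using UniformSpace.Completion.induction_on with
    | hp => exact isClosed_eq (by fun_prop) (by fun_prop)
    | ih x => rw [← MaxTensor.coe_star', hF, hF]; exact p.prod_star x

section Rep

variable {H : Type w} [NormedAddCommGroup H] [InnerProductSpace ℂ H] [CompleteSpace H]

theorem NonUnitalStarAlgHom.continuous_rep {D : Type*} [NonUnitalCStarAlgebra D]
    (π : D →⋆ₙₐ[ℂ] (H →L[ℂ] H)) : Continuous π :=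
  AddMonoidHomClass.continuous_of_bound π 1 fun a => by
    rw [one_mul]
    exact NonUnitalStarAlgHom.norm_apply_le π a

section Dense

variable {C : Type*} [NonUnitalCStarAlgebra C] {ι : A ⊗[ℂ] B →ₗ[ℂ] C} {π : C →⋆ₙₐ[ℂ] (H →L[ℂ] H)}

theorem commute_of_commute_tmul (hι : DenseRange ι) {Z : H →L[ℂ] H}
    (h : ∀ a b, Commute (π (ι (a ⊗ₜ b))) Z) (c : C) : Commute (π c) Z := by
  have hc := NonUnitalStarAlgHom.continuous_rep π
  refine hι.induction_on c
    (isClosed_eq (hc.mul continuous_const) (continuous_const.mul hc)) fun x => ?_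
  induction x with
  | zero => rw [map_zero, map_zero]; exact Commute.zero_left Z
  | add x y hx hy => rw [map_add, map_add]; exact hx.add_left hy
  | tmul a b => exact h a b

theorem apply_eq_zero_of_tmul (hι : DenseRange ι) {ξ : H} (h : ∀ a b, π (ι (a ⊗ₜ b)) ξ = 0)
    (c : C) : π c ξ = 0 := by
  have hc := NonUnitalStarAlgHom.continuous_rep π
  refine hι.induction_on c
    (isClosed_eq (hc.clm_apply continuous_const) continuous_const) fun x => ?_
  induction x with
  | zero => rw [map_zero, map_zero]; rfl
  | add x y hx hy => rw [map_add, map_add, add_apply, hx, hy, add_zero]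
  | tmul a b => exact h a b

end Dense

variable {π : MaxTensor A B →⋆ₙₐ[ℂ] (H →L[ℂ] H)}

/-- The set of operators `π(a ⊗ b)`. -/
def tmulRange (π : MaxTensor A B →⋆ₙₐ[ℂ] (H →L[ℂ] H)) : Set (H →L[ℂ] H) :=
  {T | ∃ (a : A) (b : B), T = π (MaxTensor.of (a ⊗ₜ b))}

/-- The adjoints of the operators `π(a ⊗ b)` have no common kernel. -/
theorem IsNondegenerate.total_tmulRange (hπ : IsNondegenerate (Set.range π)) (v : H)
    (hv : ∀ Y ∈ tmulRange π, adjoint Y v = 0) : v = 0 := by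
  refine hπ v ?_
  rintro _ ⟨c, rfl⟩
  refine apply_eq_zero_of_tmul MaxTensor.denseRange_of (fun a b => ?_) c
  have := hv _ ⟨star a, star b, rfl⟩
  rwa [← star_eq_adjoint, ← map_star, ← MaxTensor.of_star, TensorProduct.star_tmul, star_star,
    star_star] at this

/-- Operators are equal if they agree after multiplication by each `π(a ⊗ b)`. -/
theorem IsNondegenerate.eq_of_tmul (hπ : IsNondegenerate (Set.range π)) {T T' : H →L[ℂ] H}
    (h : ∀ a b, T * π (MaxTensor.of (a ⊗ₜ b)) = T' * π (MaxTensor.of (a ⊗ₜ b))) : T = T' := by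
  refine eq_of_total (I := tmulRange π) hπ.total_tmulRange ?_
  rintro _ ⟨a, b, rfl⟩ ξ
  exact DFunLike.congr_fun (h a b) ξ

/-- If a left multiplier `m` of `A ⊙ B` is a pointwise limit of left multiplications by a bounded
net, then it acts on the space of any nondegenerate representation. -/
theorem exists_multiplier_operator (π : MaxTensor A B →⋆ₙₐ[ℂ] (H →L[ℂ] H))
    {ι : Type*} {l : Filter ι} [l.NeBot] (m : A ⊗[ℂ] B →ₗ[ℂ] A ⊗[ℂ] B) (x : ι → A ⊗[ℂ] B) (C : ℝ)
    (hC : ∀ᶠ i in l, maxNorm (x i) ≤ C)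
    (hx : ∀ a b, Tendsto (fun i => (MaxTensor.of (x i * a ⊗ₜ[ℂ] b) : MaxTensor A B)) l
      (𝓝 (MaxTensor.of (m (a ⊗ₜ b))))) :
    ∃ T : H →L[ℂ] H, ∀ y, T * π (MaxTensor.of y) = π (MaxTensor.of (m y)) := by
  have hc := NonUnitalStarAlgHom.continuous_rep π
  let e : (A ⊗[ℂ] B) ⊗[ℂ] H →ₗ[ℂ] H := TensorProduct.lift
    (ContinuousLinearMap.coeLM ℂ ∘ₗ (π : MaxTensor A B →ₗ[ℂ] (H →L[ℂ] H)) ∘ₗ MaxTensor.of)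
  have he (y : A ⊗[ℂ] B) (ξ : H) : e (y ⊗ₜ ξ) = π (MaxTensor.of y) ξ := rfl
  let f : (A ⊗[ℂ] B) ⊗[ℂ] H →ₗ[ℂ] H := e ∘ₗ LinearMap.rTensor H m
  have hf (y : A ⊗[ℂ] B) (ξ : H) : f (y ⊗ₜ ξ) = π (MaxTensor.of (m y)) ξ := rfl
  have hlim (z : (A ⊗[ℂ] B) ⊗[ℂ] H) :
      Tendsto (fun i => π (MaxTensor.of (x i)) (e z)) l (𝓝 (f z)) := by
    induction z with
    | zero => simp
    | add z z' hz hz' => simpa only [map_add] using hz.add hz'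
    | tmul y ξ =>
      rw [he, hf]
      induction y with
      | zero => simp
      | add y y' hy hy' => simpa only [map_add, add_apply] using hy.add hy'
      | tmul a b =>
        have h1 := ((hc.clm_apply (continuous_const (y := ξ))).tendsto _).comp (hx a b)
        refine h1.congr fun i => ?_
        rw [Function.comp_apply, MaxTensor.of_mul, map_mul]
        rfl
  have hbound (z : (A ⊗[ℂ] B) ⊗[ℂ] H) : ‖f z‖ ≤ C * ‖e z‖ := by
    refine le_of_tendsto (hlim z).norm (hC.mono fun i hi => ?_)
    refine (π _).le_of_opNorm_le ((NonUnitalStarAlgHom.norm_apply_le π _).trans ?_) _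
    rwa [MaxTensor.norm_of]
  obtain ⟨T, hT, -⟩ := exists_clm_of_norm_le e f C hbound
  exact ⟨T, fun y => ext fun ξ => hT (y ⊗ₜ ξ)⟩

/-- A *-algebra `D` of multipliers of `A ⊙ B` acts on the space of a nondegenerate representation
as soon as each of its elements does. -/
theorem exists_rep_of_multipliers (hπ : IsNondegenerate (Set.range π))
    {D : Type*} [NonUnitalCStarAlgebra D] (μ : D →ₗ[ℂ] A ⊗[ℂ] B →ₗ[ℂ] A ⊗[ℂ] B)
    (hmul : ∀ d d' x, μ (d * d') x = μ d (μ d' x))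
    (hstar : ∀ d x y, star (μ d x) * y = star x * μ (star d) y)
    (hT : ∀ d, ∃ T : H →L[ℂ] H, ∀ y, T * π (MaxTensor.of y) = π (MaxTensor.of (μ d y))) :
    ∃ ρ : D →⋆ₙₐ[ℂ] (H →L[ℂ] H),
      ∀ d y, ρ d * π (MaxTensor.of y) = π (MaxTensor.of (μ d y)) := by
  choose ρ hρ using hT
  have hu {d : D} {T : H →L[ℂ] H}
      (h : ∀ y, T * π (MaxTensor.of y) = π (MaxTensor.of (μ d y))) : ρ d = T :=
    hπ.eq_of_tmul fun a b => (hρ d _).trans (h _).symm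
  refine ⟨{
    toFun := ρ
    map_smul' := fun c d => hu fun y => by
      rw [MonoidHom.id_apply, smul_mul_assoc, hρ, map_smul, LinearMap.smul_apply, map_smul, map_smul]
    map_zero' := hu fun y => by
      rw [zero_mul, map_zero, LinearMap.zero_apply, map_zero, map_zero]
    map_add' := fun d d' => hu fun y => by
      rw [add_mul, hρ, hρ, map_add, LinearMap.add_apply, map_add, map_add]
    map_mul' := fun d d' => hu fun y => by rw [mul_assoc, hρ, hρ, hmul]
    map_star' := fun d => hu fun y => ?_ }, hρ⟩
  refine ext fun ξ => sub_eq_zero.1 (hπ.total_tmulRange _ ?_)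
  rintro _ ⟨a, b, rfl⟩
  have h1 : star (π (MaxTensor.of (a ⊗ₜ b))) * (star (ρ d) * π (MaxTensor.of y)) =
      star (π (MaxTensor.of (a ⊗ₜ b))) * π (MaxTensor.of (μ (star d) y)) := by
    rw [← mul_assoc, ← star_mul, hρ, ← map_star π, ← map_star π, ← map_mul π, ← map_mul π,
      ← MaxTensor.of_star, ← MaxTensor.of_star, ← MaxTensor.of_mul, ← MaxTensor.of_mul, hstar]
  rw [map_sub, sub_eq_zero]
  exact DFunLike.congr_fun h1 ξ

open CStarAlgebra in
attribute [local instance] CStarAlgebra.spectralOrder CStarAlgebra.spectralOrderedRing in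
/-- A nondegenerate representation of `A ⊗_max B` comes from commuting representations of `A` and
`B`, obtained by letting `A` and `B` act as multipliers. -/
theorem exists_commutingPair (hπ : IsNondegenerate (Set.range π)) :
    ∃ p : CommutingPair A B H,
      (∀ a a' b', p.left a * π (MaxTensor.of (a' ⊗ₜ b')) = π (MaxTensor.of ((a * a') ⊗ₜ b'))) ∧
      (∀ b a' b', p.right b * π (MaxTensor.of (a' ⊗ₜ b')) = π (MaxTensor.of (a' ⊗ₜ (b * b')))) := by
  obtain ⟨ρ, hρ⟩ := exists_rep_of_multipliers (π := π) hπ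
    (LinearMap.rTensorHom B ∘ₗ LinearMap.mul ℂ A)
    (fun d d' x => by
      induction x with
      | zero => simp
      | add x y hx hy => simp only [map_add, hx, hy]
      | tmul a b => simp [mul_assoc])
    (fun d x y => by
      induction x with
      | zero => simp
      | add x x' hx hx' => simp only [map_add, star_add, add_mul, hx, hx']
      | tmul a b =>
        induction y with
        | zero => simp
        | add y y' hy hy' => simp only [map_add, mul_add, hy, hy']
        | tmul a' b' => simp [mul_assoc])
    (fun d => exists_multiplier_operator π (l := approximateUnit B) _ (fun u => d ⊗ₜ u) ‖d‖
      ((increasingApproximateUnit B).eventually_norm.mono fun u hu =>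
        (maxNorm_tmul_le d u).trans (mul_le_of_le_one_right (norm_nonneg _) hu))
      fun a b => by
        have h1 : Continuous fun b' : B => (MaxTensor.of ((d * a) ⊗ₜ[ℂ] b') : MaxTensor A B) :=
          AddMonoidHomClass.continuous_of_bound
            ((MaxTensor.of : A ⊗[ℂ] B →ₗ[ℂ] MaxTensor A B) ∘ₗ TensorProduct.mk ℂ A B (d * a))
            ‖d * a‖ fun b' => (MaxTensor.norm_of _).trans_le (maxNorm_tmul_le _ _)
        simpa [Function.comp_def] using (h1.tendsto b).comp ((increasingApproximateUnit B).tendsto_mul_right b))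
  obtain ⟨τ, hτ⟩ := exists_rep_of_multipliers (π := π) hπ
    (LinearMap.lTensorHom A ∘ₗ LinearMap.mul ℂ B)
    (fun d d' x => by
      induction x with
      | zero => simp
      | add x y hx hy => simp only [map_add, hx, hy]
      | tmul a b => simp [mul_assoc])
    (fun d x y => by
      induction x with
      | zero => simp
      | add x x' hx hx' => simp only [map_add, star_add, add_mul, hx, hx']
      | tmul a b =>
        induction y with
        | zero => simp
        | add y y' hy hy' => simp only [map_add, mul_add, hy, hy']
        | tmul a' b' => simp [mul_assoc])
    (fun d => exists_multiplier_operator π (l := approximateUnit A) _ (fun u => u ⊗ₜ d) ‖d‖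
      ((increasingApproximateUnit A).eventually_norm.mono fun u hu =>
        (maxNorm_tmul_le u d).trans (mul_le_of_le_one_left (norm_nonneg _) hu))
      fun a b => by
        have h1 : Continuous fun a' : A => (MaxTensor.of (a' ⊗ₜ[ℂ] (d * b)) : MaxTensor A B) :=
          AddMonoidHomClass.continuous_of_bound
            ((MaxTensor.of : A ⊗[ℂ] B →ₗ[ℂ] MaxTensor A B) ∘ₗ
              (TensorProduct.mk ℂ A B).flip (d * b))
            ‖d * b‖ fun a' => (MaxTensor.norm_of _).trans_le
              ((maxNorm_tmul_le _ _).trans_eq (mul_comm _ _))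
        simpa [Function.comp_def] using (h1.tendsto a).comp ((increasingApproximateUnit A).tendsto_mul_right a))
  have hρ' (a a' : A) (b' : B) :
      ρ a * π (MaxTensor.of (a' ⊗ₜ b')) = π (MaxTensor.of ((a * a') ⊗ₜ b')) := hρ a _
  have hτ' (b : B) (a' : A) (b' : B) :
      τ b * π (MaxTensor.of (a' ⊗ₜ b')) = π (MaxTensor.of (a' ⊗ₜ (b * b'))) := hτ b _
  refine ⟨⟨ρ, τ, fun a b => hπ.eq_of_tmul fun a' b' => ?_⟩, hρ', hτ'⟩
  rw [mul_assoc, hτ', hρ', mul_assoc, hρ', hτ']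

end Rep

/-- The property of `A ⊗_max B` on which its relation with `A** ⊙ B**` rests: the nondegenerate
representations of `C` are those given by commuting representations of `A` and `B`, through a map
`ι` of `A ⊙ B` onto a dense subspace of `C`. The Hilbert spaces are in the universe of `C`, and so
are its universal space and that of any weak* tensor product under consideration. -/
structure IsMaximalProduct {C : Type w} [NonUnitalCStarAlgebra C]
    (ι : A ⊗[ℂ] B →ₗ[ℂ] C) : Prop where
  denseRange : DenseRange ι
  exists_rep : ∀ {H : Type w} [NormedAddCommGroup H] [InnerProductSpace ℂ H]
    [CompleteSpace H] (p : CommutingPair A B H),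
    ∃ π : C →⋆ₙₐ[ℂ] (H →L[ℂ] H), ∀ x, π (ι x) = p.prod x
  exists_pair : ∀ {H : Type w} [NormedAddCommGroup H] [InnerProductSpace ℂ H]
    [CompleteSpace H] {π : C →⋆ₙₐ[ℂ] (H →L[ℂ] H)}, IsNondegenerate (Set.range π) →
    ∃ p : CommutingPair A B H, ∀ a b, p.left a * p.right b = π (ι (a ⊗ₜ b))

theorem MaxTensor.isMaximalProduct :
    IsMaximalProduct (MaxTensor.of : A ⊗[ℂ] B →ₗ[ℂ] MaxTensor A B) where
  denseRange := MaxTensor.denseRange_of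
  exists_rep p := p.exists_maxRep
  exists_pair {H} _ _ _ π hπ := by
    obtain ⟨p, hp, hp'⟩ := exists_commutingPair hπ
    refine ⟨p, fun a b => hπ.eq_of_tmul fun a' b' => ?_⟩
    rw [mul_assoc, hp', hp, ← map_mul, ← MaxTensor.of_mul, Algebra.TensorProduct.tmul_mul_tmul]

end MaxRep

/-! ### Hilbert tensor products -/

section HilbertTensor

open ContinuousLinearMap

variable (H : Type u) [NormedAddCommGroup H] [InnerProductSpace ℂ H]
  (K : Type v) [NormedAddCommGroup K] [InnerProductSpace ℂ K]

/-- The Hilbert space tensor product. -/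
abbrev HilbertTensor : Type (max u v) := UniformSpace.Completion (H ⊗[ℂ] K)

/-- The bilinear map `(ξ, η) ↦ ξ ⊗ η` into the Hilbert tensor product. -/
def hilbertMk : H →ₗ[ℂ] K →L[ℂ] HilbertTensor H K where
  toFun ξ := UniformSpace.Completion.toComplL ∘L TensorProduct.mkL ℂ H K ξ
  map_add' ξ ξ' := by ext η; simp
  map_smul' c ξ := by ext η; simp

/-- The bilinear map `(η, ξ) ↦ ξ ⊗ η` into the Hilbert tensor product. -/
def hilbertMkFlip : K →ₗ[ℂ] H →L[ℂ] HilbertTensor H K where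
  toFun η := UniformSpace.Completion.toComplL ∘L (TensorProduct.mkL ℂ H K).flip η
  map_add' ξ ξ' := by ext η; simp
  map_smul' c ξ := by ext η; simp

variable {H K}

theorem hilbertMkFlip_apply (ξ : H) (η : K) : hilbertMkFlip H K η ξ = hilbertMk H K ξ η := rfl

theorem inner_hilbertMk (ξ ξ' : H) (η η' : K) :
    ⟪hilbertMk H K ξ η, hilbertMk H K ξ' η'⟫_ℂ = ⟪ξ, ξ'⟫_ℂ * ⟪η, η'⟫_ℂ :=
  (UniformSpace.Completion.inner_coe _ _).trans (TensorProduct.inner_tmul ..)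

theorem eq_zero_of_inner_hilbertMk {v : HilbertTensor H K}
    (h : ∀ ξ η, ⟪hilbertMk H K ξ η, v⟫_ℂ = 0) : v = 0 := by
  refine (inner_self_eq_zero (𝕜 := ℂ)).1 ?_
  refine UniformSpace.Completion.induction_on (p := fun y => ⟪y, v⟫_ℂ = 0) v
    (isClosed_eq (continuous_id.inner continuous_const) continuous_const) fun z => ?_
  induction z with
  | zero => rw [UniformSpace.Completion.coe_zero, inner_zero_left]
  | add z z' hz hz' => rw [UniformSpace.Completion.coe_add, inner_add_left, hz, hz', add_zero]
  | tmul ξ η => exact h ξ η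

theorem hilbertMkFlip_total [CompleteSpace H] (v : HilbertTensor H K)
    (hv : ∀ Y ∈ LinearMap.range (hilbertMkFlip H K), adjoint Y v = 0) : v = 0 :=
  eq_zero_of_inner_hilbertMk fun ξ η => by
    rw [← hilbertMkFlip_apply, ← adjoint_inner_right, hv _ ⟨η, rfl⟩, inner_zero_right]

theorem hilbertMk_total [CompleteSpace K] (v : HilbertTensor H K)
    (hv : ∀ Y ∈ LinearMap.range (hilbertMk H K), adjoint Y v = 0) : v = 0 :=
  eq_zero_of_inner_hilbertMk fun ξ η => by
    rw [← adjoint_inner_right, hv _ ⟨ξ, rfl⟩, inner_zero_right]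

variable [CompleteSpace H] [CompleteSpace K]

/-- The representations `S ↦ S ⊗ 1` and `T ↦ 1 ⊗ T` on the Hilbert tensor product. -/
theorem exists_spatial (M : StarSubalgebra ℂ (H →L[ℂ] H)) (N : StarSubalgebra ℂ (K →L[ℂ] K)) :
    ∃ (σ : M →⋆ₐ[ℂ] (HilbertTensor H K →L[ℂ] HilbertTensor H K))
      (τ : N →⋆ₐ[ℂ] (HilbertTensor H K →L[ℂ] HilbertTensor H K)),
      (∀ S ξ η, σ S (hilbertMk H K ξ η) = hilbertMk H K ((S : H →L[ℂ] H) ξ) η) ∧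
      (∀ T ξ η, τ T (hilbertMk H K ξ η) = hilbertMk H K ξ ((T : K →L[ℂ] K) η)) ∧
      ∀ S T, Commute (σ S) (τ T) := by
  obtain ⟨σ, hσ⟩ := exists_inducedRep (LinearMap.range (hilbertMkFlip H K)) hilbertMkFlip_total M <| by
    rintro S - _ ⟨η, rfl⟩ _ ⟨η', rfl⟩
    have : adjoint (hilbertMkFlip H K η) ∘L hilbertMkFlip H K η' = ⟪η, η'⟫_ℂ • 1 := by
      refine ext fun ξ => ext_inner_left ℂ fun ξ' => ?_
      rw [comp_apply, adjoint_inner_right, hilbertMkFlip_apply, hilbertMkFlip_apply,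
        inner_hilbertMk, smul_apply, inner_smul_right, mul_comm, one_apply_eq_self]
    rw [this]
    exact (Commute.one_left S).smul_left _
  obtain ⟨τ, hτ⟩ := exists_inducedRep (LinearMap.range (hilbertMk H K)) hilbertMk_total N <| by
    rintro S - _ ⟨η, rfl⟩ _ ⟨η', rfl⟩
    have : adjoint (hilbertMk H K η) ∘L hilbertMk H K η' = ⟪η, η'⟫_ℂ • 1 := by
      refine ext fun ξ => ext_inner_left ℂ fun ξ' => ?_
      rw [comp_apply, adjoint_inner_right, inner_hilbertMk, smul_apply, inner_smul_right,
        one_apply_eq_self]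
    rw [this]
    exact (Commute.one_left S).smul_left _
  have hσ' (S : M) (ξ : H) (η : K) :
      σ S (hilbertMk H K ξ η) = hilbertMk H K ((S : H →L[ℂ] H) ξ) η := hσ S _ ⟨η, rfl⟩ ξ
  have hτ' (T : N) (ξ : H) (η : K) :
      τ T (hilbertMk H K ξ η) = hilbertMk H K ξ ((T : K →L[ℂ] K) η) := hτ T _ ⟨ξ, rfl⟩ η
  refine ⟨σ, τ, hσ', hτ', fun S T => eq_of_total
    (I := (LinearMap.range (hilbertMk H K) : Set (K →L[ℂ] HilbertTensor H K))) hilbertMk_total ?_⟩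
  rintro _ ⟨ξ, rfl⟩ η
  change σ S (τ T (hilbertMk H K ξ η)) = τ T (σ S (hilbertMk H K ξ η))
  rw [hτ', hσ', hσ', hτ']

/-- The representation of `M ⊙ N` given by commuting representations of `M` and `N`. -/
theorem exists_tensorRep {M : VonNeumannAlgebra H} {N : VonNeumannAlgebra K} {L : Type w}
    [NormedAddCommGroup L] [InnerProductSpace ℂ L] [CompleteSpace L]
    (σ : M.toStarSubalgebra →⋆ₐ[ℂ] (L →L[ℂ] L)) (τ : N.toStarSubalgebra →⋆ₐ[ℂ] (L →L[ℂ] L))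
    (h : ∀ S T, Commute (σ S) (τ T)) :
    ∃ α : AlgTensorVN M N →⋆ₐ[ℂ] (L →L[ℂ] L), ∀ S T, α (S ⊗ₜ T) = σ S * τ T := by
  refine ⟨{ Algebra.TensorProduct.lift (σ : M.toStarSubalgebra →ₐ[ℂ] (L →L[ℂ] L))
    (τ : N.toStarSubalgebra →ₐ[ℂ] (L →L[ℂ] L)) h with
    map_star' := fun x => ?_ }, fun S T => Algebra.TensorProduct.lift_tmul _ _ h S T⟩
  simp only [AlgHom.toRingHom_eq_coe, RingHom.toMonoidHom_eq_coe, OneHom.toFun_eq_coe,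
    MonoidHom.toOneHom_coe, MonoidHom.coe_coe, RingHom.coe_coe]
  induction x using TensorProduct.induction_on with
  | zero => simp
  | add x y hx hy => simp only [star_add, map_add, hx, hy]
  | tmul S T =>
    rw [TensorProduct.star_tmul, Algebra.TensorProduct.lift_tmul, Algebra.TensorProduct.lift_tmul,
      star_mul, StarAlgHom.coe_toAlgHom, StarAlgHom.coe_toAlgHom, ← map_star, ← map_star]
    exact h _ _

/-- A tensor vanishes if its slices along a separating family of functionals vanish. -/
theorem eq_zero_of_slices {V W ι : Type*} [AddCommGroup V] [Module ℂ V] [AddCommGroup W]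
    [Module ℂ W] (φ : ι → V →ₗ[ℂ] ℂ) (hφ : ∀ m, (∀ i, φ i m = 0) → m = 0) (x : V ⊗[ℂ] W)
    (h : ∀ i, TensorProduct.lift (LinearMap.lsmul ℂ W ∘ₗ φ i) x = 0) : x = 0 := by
  classical
  let b := Module.Basis.ofVectorSpace ℂ W
  let e := TensorProduct.equivFinsuppOfBasisRight (M := V) b
  have h1 (i : ι) (j) (y : V ⊗[ℂ] W) :
      b.repr (TensorProduct.lift (LinearMap.lsmul ℂ W ∘ₗ φ i) y) j = φ i (e y j) := by
    induction y with
    | zero => simp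
    | add y z hy hz => simp only [map_add, Finsupp.add_apply, hy, hz]
    | tmul m n => simp [e, mul_comm]
  refine (LinearEquiv.map_eq_zero_iff e).1 (Finsupp.ext fun j => hφ _ fun i => ?_)
  rw [← h1, h, map_zero, Finsupp.zero_apply]

/-- The spatial representation of `M ⊙ N` is injective. -/
theorem injective_of_spatial {M : VonNeumannAlgebra H} {N : VonNeumannAlgebra K}
    (α : AlgTensorVN M N →⋆ₐ[ℂ] (HilbertTensor H K →L[ℂ] HilbertTensor H K))
    (hα : ∀ (S : M.toStarSubalgebra) (T : N.toStarSubalgebra) (ξ : H) (η : K),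
      α (S ⊗ₜ T) (hilbertMk H K ξ η) = hilbertMk H K ((S : H →L[ℂ] H) ξ) ((T : K →L[ℂ] K) η)) :
    Function.Injective α := by
  refine (injective_iff_map_eq_zero α).2 fun x hx => ?_
  -- slice maps `S ⊗ T ↦ ⟪ξ', S ξ⟫ T`
  let φ (ξ' ξ : H) : M.toStarSubalgebra →ₗ[ℂ] ℂ :=
    { toFun := fun S => ⟪ξ', (S : H →L[ℂ] H) ξ⟫_ℂ
      map_add' := fun S S' => inner_add_right ..
      map_smul' := fun c S => inner_smul_right .. }
  let Λ (ξ' ξ : H) : AlgTensorVN M N →ₗ[ℂ] N.toStarSubalgebra :=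
    TensorProduct.lift (LinearMap.lsmul ℂ N.toStarSubalgebra ∘ₗ φ ξ' ξ)
  have hΛ (ξ' ξ : H) (S : M.toStarSubalgebra) (T : N.toStarSubalgebra) :
      Λ ξ' ξ (S ⊗ₜ T) = φ ξ' ξ S • T := rfl
  have h1 (ξ' ξ : H) (η' η : K) (y : AlgTensorVN M N) :
      ⟪hilbertMk H K ξ' η', α y (hilbertMk H K ξ η)⟫_ℂ =
        ⟪η', (Λ ξ' ξ y : K →L[ℂ] K) η⟫_ℂ := by
    induction y using TensorProduct.induction_on with
    | zero => simp
    | add y z hy hz =>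
      rw [map_add, map_add, add_apply, inner_add_right, hy, hz, ← inner_add_right]
      rfl
    | tmul S T =>
      rw [hα, inner_hilbertMk, hΛ]
      exact (inner_smul_right ..).symm
  refine eq_zero_of_slices (fun p : H × H => φ p.1 p.2) (fun S hS => ?_) x fun p => ?_
  · exact Subtype.ext (ext fun ξ => ext_inner_left ℂ fun ξ' =>
      (hS (ξ', ξ)).trans (inner_zero_right _).symm)
  · refine Subtype.ext (ext fun η => ext_inner_left ℂ fun η' => (h1 p.1 p.2 η' η x).symm.trans ?_)
    rw [hx, zero_apply, inner_zero_right]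
    exact (inner_zero_right _).symm

end HilbertTensor

/-! ### Separately normal representations of tensor products -/

section Factors

variable {P Q R : Type*} [Ring P] [StarRing P] [Algebra ℂ P] [StarModule ℂ P] [Ring Q] [StarRing Q]
  [Algebra ℂ Q] [StarModule ℂ Q] [Ring R] [StarRing R] [Algebra ℂ R]

/-- The restriction of a homomorphism of a tensor product to the first factor. -/
def leftFactor (α : P ⊗[ℂ] Q →⋆ₐ[ℂ] R) : P →⋆ₐ[ℂ] R where
  toAlgHom := (α : P ⊗[ℂ] Q →ₐ[ℂ] R).comp Algebra.TensorProduct.includeLeft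
  map_star' S := by
    change α (star S ⊗ₜ 1) = star (α (S ⊗ₜ 1))
    rw [← map_star, TensorProduct.star_tmul, star_one]

/-- The restriction of a homomorphism of a tensor product to the second factor. -/
def rightFactor (α : P ⊗[ℂ] Q →⋆ₐ[ℂ] R) : Q →⋆ₐ[ℂ] R where
  toAlgHom := (α : P ⊗[ℂ] Q →ₐ[ℂ] R).comp Algebra.TensorProduct.includeRight
  map_star' T := by
    change α (1 ⊗ₜ star T) = star (α (1 ⊗ₜ T))
    rw [← map_star, TensorProduct.star_tmul, star_one]

theorem leftFactor_mul_rightFactor (α : P ⊗[ℂ] Q →⋆ₐ[ℂ] R) (S : P) (T : Q) :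
    leftFactor α S * rightFactor α T = α (S ⊗ₜ T) := by
  change α (S ⊗ₜ 1) * α (1 ⊗ₜ T) = _
  rw [← map_mul, Algebra.TensorProduct.tmul_mul_tmul, mul_one, one_mul]

theorem rightFactor_mul_leftFactor (α : P ⊗[ℂ] Q →⋆ₐ[ℂ] R) (S : P) (T : Q) :
    rightFactor α T * leftFactor α S = α (S ⊗ₜ T) := by
  change α (1 ⊗ₜ T) * α (S ⊗ₜ 1) = _
  rw [← map_mul, Algebra.TensorProduct.tmul_mul_tmul, mul_one, one_mul]

theorem leftFactor_eq {α : P ⊗[ℂ] Q →⋆ₐ[ℂ] R} {σ : P →⋆ₐ[ℂ] R} {τ : Q →⋆ₐ[ℂ] R}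
    (h : ∀ S T, α (S ⊗ₜ T) = σ S * τ T) : leftFactor α = σ :=
  StarAlgHom.ext fun S => (h S 1).trans (by rw [map_one, mul_one])

theorem rightFactor_eq {α : P ⊗[ℂ] Q →⋆ₐ[ℂ] R} {σ : P →⋆ₐ[ℂ] R} {τ : Q →⋆ₐ[ℂ] R}
    (h : ∀ S T, α (S ⊗ₜ T) = σ S * τ T) : rightFactor α = τ :=
  StarAlgHom.ext fun T => (h 1 T).trans (by rw [map_one, one_mul])

end Factors

section SeparatelyNormal

variable {H : Type u} [NormedAddCommGroup H] [InnerProductSpace ℂ H] [CompleteSpace H]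
  {K : Type v} [NormedAddCommGroup K] [InnerProductSpace ℂ K] [CompleteSpace K]
  {L : Type w} [NormedAddCommGroup L] [InnerProductSpace ℂ L] [CompleteSpace L]
  {M : VonNeumannAlgebra H} {N : VonNeumannAlgebra K}

/-- A representation of `M ⊙ N` is separately normal if its restrictions to `M` and `N` are
normal. -/
structure IsSeparatelyNormal (α : AlgTensorVN M N →⋆ₐ[ℂ] (L →L[ℂ] L)) : Prop where
  left : Continuous[weakStar M.toStarSubalgebra, ultraweak L] (leftFactor α)
  right : Continuous[weakStar N.toStarSubalgebra, ultraweak L] (rightFactor α)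

variable {α : AlgTensorVN M N →⋆ₐ[ℂ] (L →L[ℂ] L)}

theorem IsWeakStarTensor.isSeparatelyNormal (hα : IsWeakStarTensor α) : IsSeparatelyNormal α :=
  ⟨@Topology.IsEmbedding.continuous _ _ _ (weakStar M.toStarSubalgebra) (ultraweak L) hα.left,
    @Topology.IsEmbedding.continuous _ _ _ (weakStar N.toStarSubalgebra) (ultraweak L) hα.right⟩

theorem isSeparatelyNormal_of_mul {σ : M.toStarSubalgebra →⋆ₐ[ℂ] (L →L[ℂ] L)}
    {τ : N.toStarSubalgebra →⋆ₐ[ℂ] (L →L[ℂ] L)} (h : ∀ S T, α (S ⊗ₜ T) = σ S * τ T)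
    (hσ : Continuous[weakStar M.toStarSubalgebra, ultraweak L] σ)
    (hτ : Continuous[weakStar N.toStarSubalgebra, ultraweak L] τ) : IsSeparatelyNormal α :=
  ⟨by rwa [leftFactor_eq h], by rwa [rightFactor_eq h]⟩

theorem IsSeparatelyNormal.continuous_left (hα : IsSeparatelyNormal α) (T : N.toStarSubalgebra) :
    Continuous[weakStar M.toStarSubalgebra, ultraweak L] fun S => α (S ⊗ₜ[ℂ] T) := by
  have h : (fun S => α (S ⊗ₜ[ℂ] T)) = fun S => leftFactor α S * rightFactor α T :=
    funext fun S => (leftFactor_mul_rightFactor α S T).symm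
  rw [h]
  let _ := ultraweak L
  let _ := ultraweak H
  have : IsSemitopologicalSemiring (L →L[ℂ] L) := isSemitopologicalSemiring_ultraweak
  exact (continuous_mul_const _).comp hα.left

theorem IsSeparatelyNormal.continuous_right (hα : IsSeparatelyNormal α) (S : M.toStarSubalgebra) :
    Continuous[weakStar N.toStarSubalgebra, ultraweak L] fun T => α (S ⊗ₜ[ℂ] T) := by
  have h : (fun T => α (S ⊗ₜ[ℂ] T)) = fun T => leftFactor α S * rightFactor α T :=
    funext fun T => (leftFactor_mul_rightFactor α S T).symm
  rw [h]
  let _ := ultraweak L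
  let _ := ultraweak K
  have : IsSemitopologicalSemiring (L →L[ℂ] L) := isSemitopologicalSemiring_ultraweak
  exact (continuous_const_mul _).comp hα.right

end SeparatelyNormal

section Restriction

open ContinuousLinearMap

variable {A : Type u} [NonUnitalCStarAlgebra A]
  {L : Type w} [NormedAddCommGroup L] [InnerProductSpace ℂ L] [CompleteSpace L]

/-- Representations of `A` that agree on a dense subset are equal. -/
theorem rep_ext {s : Set A} (hs : Dense s) {π ρ : A →⋆ₙₐ[ℂ] (L →L[ℂ] L)}
    (h : ∀ a ∈ s, π a = ρ a) (a : A) : π a = ρ a :=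
  congrFun (Continuous.ext_on hs (NonUnitalStarAlgHom.continuous_rep π)
    (NonUnitalStarAlgHom.continuous_rep ρ) h) a

/-- The restriction of a homomorphism on `A**` to `A`. -/
def restrictRep (Θ : (Enveloping A).toStarSubalgebra →⋆ₐ[ℂ] (L →L[ℂ] L)) :
    A →⋆ₙₐ[ℂ] (L →L[ℂ] L) :=
  (Θ : (Enveloping A).toStarSubalgebra →⋆ₙₐ[ℂ] (L →L[ℂ] L)).comp (toEnveloping A)

/-- Normal representations of `A**` that agree on a dense subset of `A` are equal. -/
theorem normal_ext {s : Set A} (hs : Dense s)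
    {Θ Θ' : (Enveloping A).toStarSubalgebra →⋆ₐ[ℂ] (L →L[ℂ] L)}
    (hΘ : Continuous[weakStar (Enveloping A).toStarSubalgebra, ultraweak L] Θ)
    (hΘ' : Continuous[weakStar (Enveloping A).toStarSubalgebra, ultraweak L] Θ')
    (h : ∀ a ∈ s, Θ (toEnveloping A a) = Θ' (toEnveloping A a))
    (S : (Enveloping A).toStarSubalgebra) : Θ S = Θ' S := by
  have h' : ∀ a, Θ (toEnveloping A a) = Θ' (toEnveloping A a) :=
    rep_ext (π := restrictRep Θ) (ρ := restrictRep Θ') hs h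
  exact congrFun (@eq_of_continuous_weakStar _ _ _ (ultraweak L) t2Space_ultraweak _ _ hΘ hΘ' h') S

end Restriction

/-! ### Weak* embeddings obtained by compression -/

section Compression

open ContinuousLinearMap

variable {H : Type u} [NormedAddCommGroup H] [InnerProductSpace ℂ H] [CompleteSpace H]
  {E : Type v} [NormedAddCommGroup E] [InnerProductSpace ℂ E] [CompleteSpace E]
  {L : Type w} [NormedAddCommGroup L] [InnerProductSpace ℂ L] [CompleteSpace L]

theorem continuous_ultraweak_compression (Y : H →L[ℂ] E) :
    Continuous[ultraweak E, ultraweak H] fun R : E →L[ℂ] E => adjoint Y ∘L R ∘L Y := by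
  let _ := ultraweak E
  refine continuous_ultraweak_iff.2 fun x y => ?_
  have hm (x : lp (fun _ : ℕ => H) 2) : Memℓp (fun n => Y (x n)) 2 :=
    ((lp.memℓp x).const_smul (‖Y‖ : ℂ)).mono' fun n => by
      refine (Y.le_opNorm (x n)).trans_eq ?_
      rw [Pi.smul_apply, norm_smul, Complex.norm_real, norm_norm]
  simp only [comp_apply, adjoint_inner_right]
  exact continuous_functional (⟨_, hm x⟩ : lp (fun _ : ℕ => E) 2) ⟨_, hm y⟩

/-- A weak* continuous map is an embedding if it can be undone by a weak* continuous map followed by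
a compression. -/
theorem isEmbedding_of_compression {M : StarSubalgebra ℂ (H →L[ℂ] H)}
    {N : StarSubalgebra ℂ (L →L[ℂ] L)} {f : M → L →L[ℂ] L}
    (hf : Continuous[weakStar M, ultraweak L] f) (hN : ∀ S, f S ∈ N) (Θ : N → E →L[ℂ] E)
    (hΘ : Continuous[weakStar N, ultraweak E] Θ) (Y : H →L[ℂ] E)
    (h : ∀ S ξ ζ, ⟪Y ζ, Θ ⟨f S, hN S⟩ (Y ξ)⟫_ℂ = ⟪ζ, (S : H →L[ℂ] H) ξ⟫_ℂ) :
    @Topology.IsEmbedding _ _ (weakStar M) (ultraweak L) f := by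
  have hcomp : ((fun R : E →L[ℂ] E => adjoint Y ∘L R ∘L Y) ∘ Θ) ∘
      (fun S => (⟨f S, hN S⟩ : N)) = (Subtype.val : M → H →L[ℂ] H) := by
    refine funext fun S => ext fun ξ => ext_inner_left ℂ fun ζ => ?_
    exact (adjoint_inner_right Y ζ (Θ ⟨f S, hN S⟩ (Y ξ))).trans (h S ξ ζ)
  have hf' : Continuous[weakStar M, weakStar N] fun S => (⟨f S, hN S⟩ : N) :=
    @Continuous.subtype_mk _ _ (ultraweak L) (weakStar M) _ _ hf hN
  have hg : Continuous[weakStar N, ultraweak H]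
      ((fun R : E →L[ℂ] E => adjoint Y ∘L R ∘L Y) ∘ Θ) :=
    @Continuous.comp _ _ _ (weakStar N) (ultraweak E) (ultraweak H) _ _
      (continuous_ultraweak_compression Y) hΘ
  have h1 : @Topology.IsEmbedding _ _ (weakStar M) (weakStar N) fun S => (⟨f S, hN S⟩ : N) :=
    @Topology.IsEmbedding.of_comp _ _ _ _ _ (weakStar M) (weakStar N) (ultraweak H) hf' hg (by
      rw [hcomp]
      exact @Topology.IsEmbedding.subtypeVal _ (ultraweak H) _)
  exact @Topology.IsEmbedding.comp _ _ _ _ _ (weakStar M) (weakStar N) (ultraweak L)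
    (@Topology.IsEmbedding.subtypeVal _ (ultraweak L) _) h1

end Compression

/-! ### Separately normal representations of `A** ⊙ B**` -/

section NormalFactors

open ContinuousLinearMap

variable {A : Type u} {B : Type v} [NonUnitalCStarAlgebra A] [NonUnitalCStarAlgebra B]
  {L : Type w} [NormedAddCommGroup L] [InnerProductSpace ℂ L] [CompleteSpace L]

/-- Separately weak* continuous functions on `A** × B**` are determined by their restrictions to
`A × B`. -/
theorem eq_of_separately_continuous {X : Type*} [TopologicalSpace X] [T2Space X]
    {F G : (Enveloping A).toStarSubalgebra → (Enveloping B).toStarSubalgebra → X}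
    (hF₁ : ∀ T, Continuous[weakStar _, _] fun S => F S T)
    (hF₂ : ∀ S, Continuous[weakStar _, _] (F S))
    (hG₁ : ∀ T, Continuous[weakStar _, _] fun S => G S T)
    (hG₂ : ∀ S, Continuous[weakStar _, _] (G S))
    (h : ∀ a b, F (toEnveloping A a) (toEnveloping B b) = G (toEnveloping A a) (toEnveloping B b))
    (S : (Enveloping A).toStarSubalgebra) (T : (Enveloping B).toStarSubalgebra) : F S T = G S T := by
  have h1 (a : A) : F (toEnveloping A a) = G (toEnveloping A a) :=
    eq_of_continuous_weakStar (hF₂ _) (hG₂ _) (h a)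
  exact congrFun (eq_of_continuous_weakStar (hF₁ T) (hG₁ T) fun a => congrFun (h1 a) T) S

variable {α : AlgTensorVN (Enveloping A) (Enveloping B) →⋆ₐ[ℂ] (L →L[ℂ] L)}

/-- The commuting representations of `A` and `B` given by a representation of `A** ⊙ B**`. -/
def restrictPair (α : AlgTensorVN (Enveloping A) (Enveloping B) →⋆ₐ[ℂ] (L →L[ℂ] L)) :
    CommutingPair A B L where
  left := restrictRep (leftFactor α)
  right := restrictRep (rightFactor α)
  commute := fun a b => (leftFactor_mul_rightFactor α (toEnveloping A a) (toEnveloping B b)).trans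
    (rightFactor_mul_leftFactor α (toEnveloping A a) (toEnveloping B b)).symm

theorem restrictPair_prod (x : A ⊗[ℂ] B) :
    (restrictPair α).prod x = α (algTensorToEnveloping A B x) := by
  induction x with
  | zero => rw [map_zero, map_zero, map_zero]
  | add x y hx hy => rw [map_add, map_add, map_add, hx, hy]
  | tmul a b => exact leftFactor_mul_rightFactor α (toEnveloping A a) (toEnveloping B b)

variable {C : Type*} [NonUnitalCStarAlgebra C] {ι : A ⊗[ℂ] B →ₗ[ℂ] C}

theorem restrictPair_prod_tmul {π : C →⋆ₙₐ[ℂ] (L →L[ℂ] L)}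
    (hπ : ∀ x, π (ι x) = (restrictPair α).prod x) (a : A) (b : B) :
    π (ι (a ⊗ₜ b)) = α (toEnveloping A a ⊗ₜ toEnveloping B b) :=
  (hπ _).trans (restrictPair_prod _)

/-- Two separately normal representations, followed by weak* continuous maps, agree if they do on
the elementary tensors of `A ⊙ B`. -/
theorem IsSeparatelyNormal.eq_tmul {L' : Type*} [NormedAddCommGroup L'] [InnerProductSpace ℂ L']
    [CompleteSpace L'] {α' : AlgTensorVN (Enveloping A) (Enveloping B) →⋆ₐ[ℂ] (L' →L[ℂ] L')}
    (hα : IsSeparatelyNormal α) (hα' : IsSeparatelyNormal α')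
    {X : Type*} [TopologicalSpace X] [T2Space X] {f : (L →L[ℂ] L) → X} {g : (L' →L[ℂ] L') → X}
    (hf : Continuous[ultraweak L, _] f) (hg : Continuous[ultraweak L', _] g)
    (h : ∀ a b, f (α (toEnveloping A a ⊗ₜ toEnveloping B b)) =
      g (α' (toEnveloping A a ⊗ₜ toEnveloping B b)))
    (S : (Enveloping A).toStarSubalgebra) (T : (Enveloping B).toStarSubalgebra) :
    f (α (S ⊗ₜ T)) = g (α' (S ⊗ₜ T)) :=
  eq_of_separately_continuous (F := fun S T => f (α (S ⊗ₜ T))) (G := fun S T => g (α' (S ⊗ₜ T)))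
    (fun T => @Continuous.comp _ _ _ (weakStar _) (ultraweak L) _ _ _ hf (hα.continuous_left T))
    (fun S => @Continuous.comp _ _ _ (weakStar _) (ultraweak L) _ _ _ hf (hα.continuous_right S))
    (fun T => @Continuous.comp _ _ _ (weakStar _) (ultraweak L') _ _ _ hg (hα'.continuous_left T))
    (fun S => @Continuous.comp _ _ _ (weakStar _) (ultraweak L') _ _ _ hg (hα'.continuous_right S))
    h S T

/-- A separately normal representation remains nondegenerate on `A ⊙ B`, since the
matrix coefficients of a vector annihilated by `A ⊙ B` vanish also at the unit. -/
theorem IsSeparatelyNormal.isNondegenerate (hα : IsSeparatelyNormal α)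
    {π : C →⋆ₙₐ[ℂ] (L →L[ℂ] L)} (hπ : ∀ x, π (ι x) = (restrictPair α).prod x) : IsNondegenerate (Set.range π) := by
  intro ξ hξ
  refine ext_inner_left ℂ fun ζ => ?_
  have h0 : Continuous[ultraweak L, _] fun _ : L →L[ℂ] L => (0 : ℂ) :=
    @continuous_const _ _ (ultraweak L) _ _
  have h1 := hα.eq_tmul hα (continuous_ultraweak_inner ζ ξ) h0 (fun a b => by
    rw [← restrictPair_prod_tmul hπ, hξ _ ⟨_, rfl⟩, inner_zero_right]) 1 1
  rw [← Algebra.TensorProduct.one_def, map_one] at h1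
  rw [inner_zero_right]
  exact h1

/-- What commutes with `A ⊙ B` commutes with `A** ⊙ B**`. -/
theorem IsSeparatelyNormal.commute (hα : IsSeparatelyNormal α) {Z : L →L[ℂ] L}
    (h : ∀ a b, Commute Z (α (toEnveloping A a ⊗ₜ toEnveloping B b)))
    (x : AlgTensorVN (Enveloping A) (Enveloping B)) : Commute Z (α x) := by
  induction x using TensorProduct.induction_on with
  | zero => rw [map_zero]; exact Commute.zero_right Z
  | add x y hx hy => rw [map_add]; exact hx.add_right hy
  | tmul S T =>
    let _ := ultraweak L
    have : T2Space (L →L[ℂ] L) := t2Space_ultraweak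
    have : IsSemitopologicalSemiring (L →L[ℂ] L) := isSemitopologicalSemiring_ultraweak
    exact hα.eq_tmul hα (continuous_const_mul Z) (continuous_mul_const Z) h S T

end NormalFactors

/-! ### Extension to normal homomorphisms of `C**` -/

section Lift

open ContinuousLinearMap

variable {A : Type u} {B : Type v} [NonUnitalCStarAlgebra A] [NonUnitalCStarAlgebra B]
  {C : Type w} [NonUnitalCStarAlgebra C] {ι : A ⊗[ℂ] B →ₗ[ℂ] C}

/-- The weak* closure of the range of a separately normal representation is the double commutant of
its restriction to `A ⊙ B`. -/
theorem IsSeparatelyNormal.bicommutant_eq {L : Type w} [NormedAddCommGroup L]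
    [InnerProductSpace ℂ L] [CompleteSpace L]
    {α : AlgTensorVN (Enveloping A) (Enveloping B) →⋆ₐ[ℂ] (L →L[ℂ] L)}
    (hα : IsSeparatelyNormal α) (hι : DenseRange ι) {π : C →⋆ₙₐ[ℂ] (L →L[ℂ] L)}
    (hπ : ∀ x, π (ι x) = (restrictPair α).prod x) :
    ((bicommutant (Set.range π)).toStarSubalgebra : Set (L →L[ℂ] L)) = weakStarTensor α := by
  have hαstar : ∀ g ∈ (α.range : Set (L →L[ℂ] L)), star g ∈ (α.range : Set (L →L[ℂ] L)) :=
    fun g hg => star_mem (S := StarSubalgebra ℂ (L →L[ℂ] L)) (s := α.range) hg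
  rw [weakStarTensor, coe_weakStarClosure]
  refine Set.Subset.antisymm ?_ ?_
  · intro T hT
    refine bicommutant_subset_closure α.range.toNonUnitalStarSubalgebra (fun ξ hξ => ?_) ?_
    · exact hξ 1 (one_mem α.range)
    · refine (mem_bicommutant hαstar).2 fun Z hZ =>
        mem_bicommutant_range.1 hT Z (commute_of_commute_tmul hι fun a b => ?_)
      rw [restrictPair_prod_tmul hπ]
      exact hZ _ ⟨_, rfl⟩
  · refine @closure_minimal _ (ultraweak L) _ _ ?_ (isClosed_bicommutant _)
    rintro _ ⟨x, rfl⟩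
    refine mem_bicommutant_range.2 fun Z hZ => hα.commute (fun a b => ?_) x
    rw [← restrictPair_prod_tmul hπ]
    exact (hZ _).symm

/-- A separately normal representation `α` of `A** ⊙ B**` extends, from `A ⊙ B`, to a normal
homomorphism of `C**` onto the weak* closure of the range of `α`. -/
theorem IsSeparatelyNormal.exists_lift {L : Type w} [NormedAddCommGroup L]
    [InnerProductSpace ℂ L] [CompleteSpace L]
    {α : AlgTensorVN (Enveloping A) (Enveloping B) →⋆ₐ[ℂ] (L →L[ℂ] L)}
    (hα : IsSeparatelyNormal α) (hι : IsMaximalProduct ι) :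
    ∃ Θ : (Enveloping C).toStarSubalgebra →⋆ₐ[ℂ] (L →L[ℂ] L),
      Continuous[weakStar (Enveloping C).toStarSubalgebra, ultraweak L] Θ ∧
      (∀ x, Θ (toEnveloping C (ι x)) = α (algTensorToEnveloping A B x)) ∧
      Set.range Θ = weakStarTensor α := by
  obtain ⟨π, hπ⟩ := hι.exists_rep (restrictPair α)
  obtain ⟨Θ, hΘ, hΘπ, hr⟩ := exists_normal_extension π (hα.isNondegenerate hπ)
  exact ⟨Θ, hΘ, fun x => (hΘπ _).trans ((hπ x).trans (restrictPair_prod x)),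
    hr.trans (hα.bicommutant_eq hι.denseRange hπ)⟩

variable {L : Type w} [NormedAddCommGroup L] [InnerProductSpace ℂ L] [CompleteSpace L]

theorem isNondegenerate_of_intertwining {H : Type v} [NormedAddCommGroup H] [InnerProductSpace ℂ H]
    [CompleteSpace H] {ρ : A →⋆ₙₐ[ℂ] (H →L[ℂ] H)} (hρ : IsNondegenerate (Set.range ρ))
    (π : A →⋆ₙₐ[ℂ] (L →L[ℂ] L)) (I : Set (H →L[ℂ] L))
    (hI : ∀ v, (∀ Y ∈ I, adjoint Y v = 0) → v = 0)
    (hπ : ∀ a, ∀ Y ∈ I, ∀ ξ, π a (Y ξ) = Y (ρ a ξ)) : IsNondegenerate (Set.range π) := by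
  refine fun v hv => hI v fun Y hY => hρ _ ?_
  rintro _ ⟨a, rfl⟩
  refine ext_inner_left ℂ fun ξ => ?_
  have h3 : ⟪π (star a) (Y ξ), v⟫_ℂ = ⟪Y ξ, π a v⟫_ℂ := by
    rw [adjoint_apply_map, star_star]
  rw [hv _ ⟨a, rfl⟩, inner_zero_right, hπ _ Y hY] at h3
  rw [inner_zero_right, ← star_star a, ← adjoint_apply_map, adjoint_inner_right]
  exact h3

/-- A *-homomorphism on `A**` that is intertwined with the inclusion of `A**` by a total set of
operators is normal. -/
theorem continuous_of_intertwining
    (σ : (Enveloping A).toStarSubalgebra →⋆ₐ[ℂ] (L →L[ℂ] L)) (I : Set (UniversalSpace A →L[ℂ] L))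
    (hI : ∀ v, (∀ Y ∈ I, adjoint Y v = 0) → v = 0)
    (hσ : ∀ S, ∀ Y ∈ I, ∀ ξ, σ S (Y ξ) = Y ((S : UniversalSpace A →L[ℂ] UniversalSpace A) ξ)) :
    Continuous[weakStar (Enveloping A).toStarSubalgebra, ultraweak L] σ := by
  have hπ : IsNondegenerate (Set.range (restrictRep σ)) :=
    isNondegenerate_of_intertwining isNondegenerate_universalRep _ I hI fun a => hσ (toEnveloping A a)
  obtain ⟨Θ, hΘ, hΘπ, -⟩ := exists_normal_extension (restrictRep σ) hπ
  have h (S) (Y : UniversalSpace A →L[ℂ] L) (hY : Y ∈ I) (ξ) (ζ) :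
      ⟪ζ, σ S (Y ξ)⟫_ℂ = ⟪ζ, Θ S (Y ξ)⟫_ℂ := by
    refine congrFun (eq_of_continuous_weakStar (f := fun S => ⟪ζ, σ S (Y ξ)⟫_ℂ)
      (g := fun S => ⟪ζ, Θ S (Y ξ)⟫_ℂ) ?_ ?_ fun a => ?_) S
    · have h1 : (fun S => ⟪ζ, σ S (Y ξ)⟫_ℂ) = fun S : (Enveloping A).toStarSubalgebra =>
          ⟪adjoint Y ζ, (S : UniversalSpace A →L[ℂ] UniversalSpace A) ξ⟫_ℂ :=
        funext fun S => (congrArg (inner ℂ ζ) (hσ S Y hY ξ)).trans (adjoint_inner_left Y _ ζ).symm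
      rw [h1]
      exact @Continuous.comp _ _ _ (weakStar _) (ultraweak _) _ _ _
        (continuous_ultraweak_inner (adjoint Y ζ) ξ) (@continuous_induced_dom _ _ _ (ultraweak _))
    · exact @Continuous.comp _ _ _ (weakStar _) (ultraweak _) _ _ _
        (continuous_ultraweak_inner ζ (Y ξ)) hΘ
    · exact congrArg (fun R : L →L[ℂ] L => ⟪ζ, R (Y ξ)⟫_ℂ) (hΘπ a).symm
  have : σ = Θ := StarAlgHom.ext fun S =>
    eq_of_total hI fun Y hY ξ => ext_inner_left ℂ fun ζ => h S Y hY ξ ζ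
  rw [this]
  exact hΘ

end Lift

/-! ### The canonical representation of `A** ⊙ B**` -/

section Canonical

open ContinuousLinearMap

variable {A : Type u} {B : Type v} [NonUnitalCStarAlgebra A] [NonUnitalCStarAlgebra B]
  {C : Type w} [NonUnitalCStarAlgebra C] {ι : A ⊗[ℂ] B →ₗ[ℂ] C}

theorem IsMaximalProduct.isNondegenerate (hι : IsMaximalProduct ι) {L : Type w}
    [NormedAddCommGroup L] [InnerProductSpace ℂ L] [CompleteSpace L] {π : C →⋆ₙₐ[ℂ] (L →L[ℂ] L)}
    (hπ : IsNondegenerate (Set.range π)) {p : CommutingPair A B L}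
    (hp : ∀ a b, p.left a * p.right b = π (ι (a ⊗ₜ b))) :
    IsNondegenerate (Set.range p.left) ∧ IsNondegenerate (Set.range p.right) := by
  constructor
  · intro ξ hξ
    refine hπ ξ ?_
    rintro _ ⟨c, rfl⟩
    refine apply_eq_zero_of_tmul hι.denseRange (fun a b => ?_) c
    rw [← hp, (p.commute a b).eq]
    exact (congrArg (p.right b) (hξ _ ⟨a, rfl⟩)).trans (map_zero _)
  · intro ξ hξ
    refine hπ ξ ?_
    rintro _ ⟨c, rfl⟩
    refine apply_eq_zero_of_tmul hι.denseRange (fun a b => ?_) c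
    rw [← hp]
    exact (congrArg (p.left a) (hξ _ ⟨b, rfl⟩)).trans (map_zero _)

theorem apply_algTensorToEnveloping {L : Type*} [NormedAddCommGroup L] [InnerProductSpace ℂ L]
    [CompleteSpace L] {π : C →⋆ₙₐ[ℂ] (L →L[ℂ] L)}
    {α : AlgTensorVN (Enveloping A) (Enveloping B) →⋆ₐ[ℂ] (L →L[ℂ] L)}
    (h : ∀ a b, α (toEnveloping A a ⊗ₜ toEnveloping B b) = π (ι (a ⊗ₜ b))) (x : A ⊗[ℂ] B) :
    α (algTensorToEnveloping A B x) = π (ι x) := by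
  have h3 : (restrictPair α).prod = (π : C →ₗ[ℂ] (L →L[ℂ] L)) ∘ₗ ι := TensorProduct.ext' fun a b =>
    (restrictPair_prod (a ⊗ₜ b)).trans (h a b)
  exact (restrictPair_prod x).symm.trans (DFunLike.congr_fun h3 x)

/-- A nondegenerate representation of `C` extends, from `A ⊙ B`, to a separately normal
representation of `A** ⊙ B**`. -/
theorem IsMaximalProduct.exists_isSeparatelyNormal (hι : IsMaximalProduct ι) {L : Type w}
    [NormedAddCommGroup L] [InnerProductSpace ℂ L] [CompleteSpace L] {π : C →⋆ₙₐ[ℂ] (L →L[ℂ] L)}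
    (hπ : IsNondegenerate (Set.range π)) :
    ∃ α : AlgTensorVN (Enveloping A) (Enveloping B) →⋆ₐ[ℂ] (L →L[ℂ] L),
      IsSeparatelyNormal α ∧ ∀ x, α (algTensorToEnveloping A B x) = π (ι x) := by
  obtain ⟨p, hp⟩ := hι.exists_pair hπ
  obtain ⟨h1, h2⟩ := hι.isNondegenerate hπ hp
  obtain ⟨σ, hσ, hσp, -⟩ := exists_normal_extension p.left h1
  obtain ⟨τ, hτ, hτp, -⟩ := exists_normal_extension p.right h2
  have hc (S) (T) : σ S * τ T = τ T * σ S := by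
    let _ := ultraweak L
    have : T2Space (L →L[ℂ] L) := t2Space_ultraweak
    have : IsSemitopologicalSemiring (L →L[ℂ] L) := isSemitopologicalSemiring_ultraweak
    refine eq_of_separately_continuous (F := fun S T => σ S * τ T) (G := fun S T => τ T * σ S)
      (fun T => ?_) (fun S => ?_) (fun T => ?_) (fun S => ?_) (fun a b => ?_) S T
    · exact @Continuous.comp _ _ _ (weakStar _) (ultraweak L) _ _ _ (continuous_mul_const (τ T)) hσ
    · exact @Continuous.comp _ _ _ (weakStar _) (ultraweak L) _ _ _ (continuous_const_mul (σ S)) hτ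
    · exact @Continuous.comp _ _ _ (weakStar _) (ultraweak L) _ _ _ (continuous_const_mul (τ T)) hσ
    · exact @Continuous.comp _ _ _ (weakStar _) (ultraweak L) _ _ _ (continuous_mul_const (σ S)) hτ
    · rw [hσp, hτp]
      exact p.commute a b
  obtain ⟨α, hα⟩ := exists_tensorRep σ τ hc
  refine ⟨α, isSeparatelyNormal_of_mul hα hσ hτ, apply_algTensorToEnveloping fun a b => ?_⟩
  rw [hα, hσp, hτp, hp]

theorem continuous_subtype {H : Type w} [NormedAddCommGroup H] [InnerProductSpace ℂ H]
    [CompleteSpace H] (M : StarSubalgebra ℂ (H →L[ℂ] H)) :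
    Continuous[weakStar M, ultraweak H] M.subtype :=
  @continuous_induced_dom _ _ _ (ultraweak H)

/-- The range of the canonical representation is weak* dense in `C**`: its lift is the inclusion of
`C**`. -/
theorem weakStarTensor_eq_enveloping (hι : IsMaximalProduct ι)
    {α : AlgTensorVN (Enveloping A) (Enveloping B) →⋆ₐ[ℂ] (UniversalSpace C →L[ℂ] UniversalSpace C)}
    (hα : IsSeparatelyNormal α) (h : ∀ x, α (algTensorToEnveloping A B x) = universalRep C (ι x)) :
    weakStarTensor α = (Enveloping C).toStarSubalgebra := by
  obtain ⟨Θ, hΘ, hΘι, hr⟩ := hα.exists_lift hι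
  have h1 (S : (Enveloping C).toStarSubalgebra) : Θ S = (Enveloping C).toStarSubalgebra.subtype S := by
    refine normal_ext hι.denseRange hΘ (continuous_subtype _) ?_ S
    rintro _ ⟨x, rfl⟩
    exact (hΘι x).trans (h x)
  refine SetLike.coe_injective (hr.symm.trans (Set.ext fun T => ⟨?_, fun hT => ⟨⟨T, hT⟩, h1 _⟩⟩))
  rintro ⟨S, rfl⟩
  rw [h1]
  exact S.2

/-- The lift of a separately normal representation `β` recovers `β` along the canonical
representation. -/
theorem lift_apply {L : Type w} [NormedAddCommGroup L] [InnerProductSpace ℂ L] [CompleteSpace L]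
    {α : AlgTensorVN (Enveloping A) (Enveloping B) →⋆ₐ[ℂ] (UniversalSpace C →L[ℂ] UniversalSpace C)}
    (hα : IsSeparatelyNormal α) (h : ∀ x, α (algTensorToEnveloping A B x) = universalRep C (ι x))
    (hC : ∀ x, α x ∈ (Enveloping C).toStarSubalgebra)
    {β : AlgTensorVN (Enveloping A) (Enveloping B) →⋆ₐ[ℂ] (L →L[ℂ] L)}
    (hβ : IsSeparatelyNormal β) {Θ : (Enveloping C).toStarSubalgebra →⋆ₐ[ℂ] (L →L[ℂ] L)}
    (hΘ : Continuous[weakStar (Enveloping C).toStarSubalgebra, ultraweak L] Θ)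
    (hΘι : ∀ x, Θ (toEnveloping C (ι x)) = β (algTensorToEnveloping A B x))
    (x : AlgTensorVN (Enveloping A) (Enveloping B)) : Θ ⟨α x, hC x⟩ = β x := by
  induction x using TensorProduct.induction_on with
  | zero =>
    have h0 : (⟨α 0, hC 0⟩ : (Enveloping C).toStarSubalgebra) = 0 := Subtype.ext (map_zero α)
    rw [h0, map_zero Θ, map_zero β]
  | add x y hx hy =>
    have h0 : (⟨α (x + y), hC (x + y)⟩ : (Enveloping C).toStarSubalgebra) =
        ⟨α x, hC x⟩ + ⟨α y, hC y⟩ := Subtype.ext (map_add α x y)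
    rw [h0, map_add Θ, map_add β, hx, hy]
  | tmul S T =>
    refine @eq_of_separately_continuous _ _ _ _ _ (ultraweak L) t2Space_ultraweak
      (fun S T => Θ ⟨α (S ⊗ₜ T), hC _⟩) (fun S T => β (S ⊗ₜ T)) (fun T => ?_) (fun S => ?_)
      hβ.continuous_left hβ.continuous_right (fun a b => ?_) S T
    · exact @Continuous.comp _ _ _ (weakStar _) (weakStar _) (ultraweak L) _ _ hΘ
        (@Continuous.subtype_mk _ _ (ultraweak _) (weakStar _) _ _ (hα.continuous_left T) _)
    · exact @Continuous.comp _ _ _ (weakStar _) (weakStar _) (ultraweak L) _ _ hΘ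
        (@Continuous.subtype_mk _ _ (ultraweak _) (weakStar _) _ _ (hα.continuous_right S) _)
    · exact (congrArg Θ (Subtype.ext (h (a ⊗ₜ b)))).trans (hΘι (a ⊗ₜ b))

end Canonical

/-! ### Normal homomorphisms between weak* closed *-algebras -/

section NormalMaps

variable {H : Type u} [NormedAddCommGroup H] [InnerProductSpace ℂ H] [CompleteSpace H]
  {K : Type v} [NormedAddCommGroup K] [InnerProductSpace ℂ K] [CompleteSpace K]
  {M M' : StarSubalgebra ℂ (H →L[ℂ] H)} {N : StarSubalgebra ℂ (K →L[ℂ] K)}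

theorem exists_normal_codRestrict {Θ : M →⋆ₐ[ℂ] (K →L[ℂ] K)}
    (hΘ : Continuous[weakStar M, ultraweak K] Θ) (hr : Set.range Θ = N) :
    ∃ Ψ : M →⋆ₐ[ℂ] N, IsNormalMap Ψ ∧ Function.Surjective Ψ ∧ ∀ S, (Ψ S : K →L[ℂ] K) = Θ S := by
  have h (S : M) : Θ S ∈ N := hr.le ⟨S, rfl⟩
  refine ⟨Θ.codRestrict N h, @Continuous.subtype_mk _ _ (ultraweak K) (weakStar M) _ _ hΘ h,
    fun T => ?_, fun S => rfl⟩
  obtain ⟨S, hS⟩ := hr.ge T.2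
  exact ⟨S, Subtype.ext hS⟩

/-- A normal homomorphism of `M` onto `N` with a normal left inverse is a normal isomorphism. -/
theorem exists_normal_equiv {Φ : M →⋆ₐ[ℂ] N} (hΦ : IsNormalMap Φ) (hs : Function.Surjective Φ)
    {Ψ : N → M'} (hΨ : IsNormalMap Ψ) (h : ∀ S, (Ψ (Φ S) : H →L[ℂ] H) = S) :
    ∃ Φ' : M ≃⋆ₐ[ℂ] N, IsNormalMap Φ' ∧ IsNormalMap Φ'.symm ∧ ∀ S, Φ' S = Φ S := by
  have hi : Function.Injective Φ := fun S S' hS => Subtype.ext (by rw [← h, hS, h])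
  let Φ' : M ≃⋆ₐ[ℂ] N := StarAlgEquiv.ofBijective Φ ⟨hi, hs⟩
  have h1 (T : N) : (Φ'.symm T : H →L[ℂ] H) = Ψ T := by
    obtain ⟨S, rfl⟩ := hs T
    exact (congrArg Subtype.val (StarAlgEquiv.symm_apply_apply Φ' S)).trans (h S).symm
  refine ⟨Φ', hΦ, ?_, fun S => rfl⟩
  have h2 : Continuous[weakStar N, ultraweak H] fun T => (Φ'.symm T : H →L[ℂ] H) := by
    rw [funext h1]
    exact @Continuous.comp _ _ _ (weakStar N) (weakStar M') (ultraweak H) _ _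
      (@continuous_induced_dom _ _ _ (ultraweak H)) hΨ
  exact @Continuous.subtype_mk _ _ (ultraweak H) (weakStar N) _ _ h2 fun T => (Φ'.symm T).2

end NormalMaps

/-! ### Spatial representations -/

section Spatial

/-- A separately normal representation `β` of `M ⊙ N` is spatial if it is injective and the
restrictions of `β` to `M` and `N` compress to the identity representations of `M` and `N`. -/
structure IsSpatial {H : Type u} [NormedAddCommGroup H] [InnerProductSpace ℂ H] [CompleteSpace H]
    {K : Type v} [NormedAddCommGroup K] [InnerProductSpace ℂ K] [CompleteSpace K]
    {L : Type w} [NormedAddCommGroup L] [InnerProductSpace ℂ L] [CompleteSpace L]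
    {M : VonNeumannAlgebra H} {N : VonNeumannAlgebra K}
    (β : AlgTensorVN M N →⋆ₐ[ℂ] (L →L[ℂ] L)) : Prop extends IsSeparatelyNormal β where
  injective : Function.Injective β
  exists_left : ∃ Y : H →L[ℂ] L, ∀ (S : M.toStarSubalgebra) ξ ζ,
    ⟪Y ζ, β (S ⊗ₜ 1) (Y ξ)⟫_ℂ = ⟪ζ, (S : H →L[ℂ] H) ξ⟫_ℂ
  exists_right : ∃ Y : K →L[ℂ] L, ∀ (T : N.toStarSubalgebra) ξ ζ,
    ⟪Y ζ, β (1 ⊗ₜ T) (Y ξ)⟫_ℂ = ⟪ζ, (T : K →L[ℂ] K) ξ⟫_ℂ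

theorem exists_norm_eq_one (H : Type u) [NormedAddCommGroup H] [InnerProductSpace ℂ H]
    [Nontrivial H] : ∃ e : H, ⟪e, e⟫_ℂ = 1 := by
  obtain ⟨e, he⟩ := exists_norm_eq H zero_le_one
  exact ⟨e, by rw [inner_self_eq_norm_sq_to_K, he]; simp⟩

/-- For unit vectors `e`, the compressions to `ξ ⊗ e` and `e ⊗ η` recover the operators of `M` and
`N`. -/
theorem isSpatial_of_mul {H : Type u} [NormedAddCommGroup H] [InnerProductSpace ℂ H]
    [CompleteSpace H] {K : Type v} [NormedAddCommGroup K] [InnerProductSpace ℂ K] [CompleteSpace K]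
    [Nontrivial H] [Nontrivial K] {M : VonNeumannAlgebra H} {N : VonNeumannAlgebra K}
    {β : AlgTensorVN M N →⋆ₐ[ℂ] (HilbertTensor H K →L[ℂ] HilbertTensor H K)}
    (hn : IsSeparatelyNormal β)
    (h : ∀ (S : M.toStarSubalgebra) (T : N.toStarSubalgebra) (ξ : H) (η : K),
      β (S ⊗ₜ T) (hilbertMk H K ξ η) = hilbertMk H K ((S : H →L[ℂ] H) ξ) ((T : K →L[ℂ] K) η)) :
    IsSpatial β where
  toIsSeparatelyNormal := hn
  injective := injective_of_spatial β h
  exists_left := by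
    obtain ⟨e, he⟩ := exists_norm_eq_one K
    refine ⟨hilbertMkFlip H K e, fun S ξ ζ => ?_⟩
    rw [hilbertMkFlip_apply, hilbertMkFlip_apply, h, inner_hilbertMk]
    exact (congrArg (_ * ·) he).trans (mul_one _)
  exists_right := by
    obtain ⟨e, he⟩ := exists_norm_eq_one H
    refine ⟨hilbertMk H K e, fun T ξ ζ => ?_⟩
    rw [h, inner_hilbertMk]
    exact (congrArg (· * _) he).trans (one_mul _)

/-- The representation of `A** ⊙ B**` on the Hilbert tensor product of the universal spaces is
spatial. The spaces are nonzero because `A` and `B` are. -/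
theorem exists_isSpatial (A : Type u) (B : Type v) [NonUnitalCStarAlgebra A]
    [NonUnitalCStarAlgebra B] [Nontrivial A] [Nontrivial B] :
    ∃ (L : Type (max u v)) (_ : NormedAddCommGroup L) (_ : InnerProductSpace ℂ L)
      (_ : CompleteSpace L) (β : AlgTensorVN (Enveloping A) (Enveloping B) →⋆ₐ[ℂ] (L →L[ℂ] L)),
      IsSpatial β := by
  obtain ⟨σ, τ, hσ, hτ, h⟩ :=
    exists_spatial (Enveloping A).toStarSubalgebra (Enveloping B).toStarSubalgebra
  obtain ⟨β, hβ⟩ := exists_tensorRep σ τ h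
  have := nontrivial_universalSpace (A := A)
  have := nontrivial_universalSpace (A := B)
  refine ⟨_, _, _, inferInstance, β, isSpatial_of_mul (isSeparatelyNormal_of_mul hβ ?_ ?_) ?_⟩
  · refine continuous_of_intertwining σ
      (I := (LinearMap.range (hilbertMkFlip (UniversalSpace A) (UniversalSpace B)) :
        Set (UniversalSpace A →L[ℂ] HilbertTensor (UniversalSpace A) (UniversalSpace B))))
      hilbertMkFlip_total ?_
    rintro S _ ⟨η, rfl⟩ ξ
    exact hσ S ξ η
  · refine continuous_of_intertwining τ
      (I := (LinearMap.range (hilbertMk (UniversalSpace A) (UniversalSpace B)) :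
        Set (UniversalSpace B →L[ℂ] HilbertTensor (UniversalSpace A) (UniversalSpace B))))
      hilbertMk_total ?_
    rintro T _ ⟨ξ, rfl⟩ η
    exact hτ T ξ η
  · intro S T ξ η
    rw [hβ]
    exact (congrArg (σ S) (hτ T ξ η)).trans (hσ S ξ _)

end Spatial

/-! ### Maximality of the canonical representation -/

section Maximality

variable {A : Type u} {B : Type v} [NonUnitalCStarAlgebra A] [NonUnitalCStarAlgebra B]
  {C : Type w} [NonUnitalCStarAlgebra C] {ι : A ⊗[ℂ] B →ₗ[ℂ] C}
  {α : AlgTensorVN (Enveloping A) (Enveloping B) →⋆ₐ[ℂ] (UniversalSpace C →L[ℂ] UniversalSpace C)}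

theorem mem_enveloping (hι : IsMaximalProduct ι) (hα : IsSeparatelyNormal α)
    (h : ∀ x, α (algTensorToEnveloping A B x) = universalRep C (ι x))
    (x : AlgTensorVN (Enveloping A) (Enveloping B)) : α x ∈ (Enveloping C).toStarSubalgebra :=
  (weakStarTensor_eq_enveloping hι hα h).le (toWeakStarTensor α x).2

/-- The canonical representation of `A** ⊙ B**` defines a weak* tensor product, since a spatial
representation factors through it. -/
theorem isWeakStarTensor_canonical (hι : IsMaximalProduct ι) (hα : IsSeparatelyNormal α)
    (h : ∀ x, α (algTensorToEnveloping A B x) = universalRep C (ι x))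
    {L : Type w} [NormedAddCommGroup L] [InnerProductSpace ℂ L] [CompleteSpace L]
    {β : AlgTensorVN (Enveloping A) (Enveloping B) →⋆ₐ[ℂ] (L →L[ℂ] L)} (hβ : IsSpatial β) :
    IsWeakStarTensor α := by
  have hC := mem_enveloping hι hα h
  obtain ⟨Θ, hΘ, hΘι, -⟩ := hβ.toIsSeparatelyNormal.exists_lift hι
  have hl := lift_apply hα h hC hβ.toIsSeparatelyNormal hΘ hΘι
  constructor
  · intro x y hxy
    refine hβ.injective ?_
    rw [← hl, ← hl]
    exact congrArg Θ (Subtype.ext hxy)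
  · obtain ⟨Y, hY⟩ := hβ.exists_left
    refine isEmbedding_of_compression (hα.continuous_left 1) (fun S => hC (S ⊗ₜ 1)) Θ hΘ Y
      fun S ξ ζ => ?_
    rw [hl]
    exact hY S ξ ζ
  · obtain ⟨Y, hY⟩ := hβ.exists_right
    refine isEmbedding_of_compression (hα.continuous_right 1) (fun T => hC (1 ⊗ₜ T)) Θ hΘ Y
      fun T ξ ζ => ?_
    rw [hl]
    exact hY T ξ ζ

/-- Any weak* tensor product is a quotient of the canonical one, by the lift of its representation
to `C**`. -/
theorem isMaxWeakStarTensor_canonical (hι : IsMaximalProduct ι) (hα : IsWeakStarTensor α)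
    (h : ∀ x, α (algTensorToEnveloping A B x) = universalRep C (ι x)) : IsMaxWeakStarTensor α := by
  refine ⟨hα, fun L _ _ _ β hβ => ?_⟩
  have hC := mem_enveloping hι hα.isSeparatelyNormal h
  obtain ⟨Θ, hΘ, hΘι, hr⟩ := hβ.isSeparatelyNormal.exists_lift hι
  have hl := lift_apply hα.isSeparatelyNormal h hC hβ.isSeparatelyNormal hΘ hΘι
  obtain ⟨Ψ, hΨ, hs, hΨΘ⟩ := exists_normal_codRestrict hΘ hr
  have hΨα (x) : Ψ ⟨α x, hC x⟩ = toWeakStarTensor β x := Subtype.ext ((hΨΘ _).trans (hl x))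
  -- `C**` and `A** ⊗̄_α B**` are equal, but not by definition: `Ψ` is moved along the equality
  have key : ∀ M : StarSubalgebra ℂ (UniversalSpace C →L[ℂ] UniversalSpace C),
      (Enveloping C).toStarSubalgebra = M → ∀ hM : ∀ x, α x ∈ M,
      ∃ Ψ : M →⋆ₐ[ℂ] weakStarTensor β, IsNormalMap Ψ ∧ Function.Surjective Ψ ∧
        ∀ x, Ψ ⟨α x, hM x⟩ = toWeakStarTensor β x := by
    rintro M rfl hM
    exact ⟨Ψ, hΨ, hs, hΨα⟩
  exact key _ (weakStarTensor_eq_enveloping hι hα.isSeparatelyNormal h).symm _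

/-- The lift to `C**` of a maximal weak* tensor product is an isomorphism: maximality, applied to the
canonical representation, gives the inverse. -/
theorem exists_equiv_of_isMaxWeakStarTensor (hι : IsMaximalProduct ι) (hα : IsWeakStarTensor α)
    (h : ∀ x, α (algTensorToEnveloping A B x) = universalRep C (ι x))
    {L : Type w} [NormedAddCommGroup L] [InnerProductSpace ℂ L] [CompleteSpace L]
    {β : AlgTensorVN (Enveloping A) (Enveloping B) →⋆ₐ[ℂ] (L →L[ℂ] L)}
    (hβ : IsMaxWeakStarTensor β) :
    ∃ Φ : (Enveloping C).toStarSubalgebra ≃⋆ₐ[ℂ] weakStarTensor β,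
      IsNormalMap Φ ∧ IsNormalMap Φ.symm ∧
      ∀ x : A ⊗[ℂ] B, Φ (toEnveloping C (ι x)) =
        toWeakStarTensor β (algTensorToEnveloping A B x) := by
  obtain ⟨Θ, hΘ, hΘι, hr⟩ := hβ.1.isSeparatelyNormal.exists_lift hι
  obtain ⟨Φ, hΦ, hs, hΦΘ⟩ := exists_normal_codRestrict hΘ hr
  have hΦι (x : A ⊗[ℂ] B) : Φ (toEnveloping C (ι x)) =
      toWeakStarTensor β (algTensorToEnveloping A B x) := Subtype.ext ((hΦΘ _).trans (hΘι x))
  obtain ⟨Ψ, hΨ, -, hΨβ⟩ := hβ.2 (UniversalSpace C) α hα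
  have hinv (S : (Enveloping C).toStarSubalgebra) :
      ((weakStarTensor α).subtype.comp (Ψ.comp Φ)) S =
        (Enveloping C).toStarSubalgebra.subtype S := by
    refine normal_ext hι.denseRange ?_ (continuous_subtype _) ?_ S
    · rw [StarAlgHom.coe_comp, StarAlgHom.coe_comp]
      exact @Continuous.comp _ _ _ (weakStar _) (weakStar _) (ultraweak _) _ _
        (continuous_subtype _) (@Continuous.comp _ _ _ (weakStar _) (weakStar _) (weakStar _) _ _
          hΨ hΦ)
    · rintro _ ⟨x, rfl⟩
      refine Eq.trans ?_ (h x)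
      change (Ψ (Φ (toEnveloping C (ι x)))).val = _
      rw [hΦι, hΨβ]
      rfl
  obtain ⟨Φ', h1, h2, h3⟩ := exists_normal_equiv hΦ hs hΨ hinv
  exact ⟨Φ', h1, h2, fun x => (h3 _).trans (hΦι x)⟩

theorem IsMaximalProduct.exists_canonical (hι : IsMaximalProduct ι)
    (hs : ∃ (L : Type w) (_ : NormedAddCommGroup L) (_ : InnerProductSpace ℂ L)
      (_ : CompleteSpace L) (β : AlgTensorVN (Enveloping A) (Enveloping B) →⋆ₐ[ℂ] (L →L[ℂ] L)),
      IsSpatial β) :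
    ∃ α : AlgTensorVN (Enveloping A) (Enveloping B) →⋆ₐ[ℂ]
      (UniversalSpace C →L[ℂ] UniversalSpace C), IsWeakStarTensor α ∧
      ∀ x, α (algTensorToEnveloping A B x) = universalRep C (ι x) := by
  obtain ⟨α, hα, h⟩ := hι.exists_isSeparatelyNormal isNondegenerate_universalRep
  obtain ⟨L, _, _, _, β, hβ⟩ := hs
  exact ⟨α, isWeakStarTensor_canonical hι hα h hβ, h⟩

theorem IsMaximalProduct.exists_max_and_equiv (hι : IsMaximalProduct ι)
    (hs : ∃ (L : Type w) (_ : NormedAddCommGroup L) (_ : InnerProductSpace ℂ L)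
      (_ : CompleteSpace L) (β : AlgTensorVN (Enveloping A) (Enveloping B) →⋆ₐ[ℂ] (L →L[ℂ] L)),
      IsSpatial β) :
    (∃ (K : Type w) (_ : NormedAddCommGroup K) (_ : InnerProductSpace ℂ K)
      (_ : CompleteSpace K) (α : AlgTensorVN (Enveloping A) (Enveloping B) →⋆ₐ[ℂ] (K →L[ℂ] K)),
      IsMaxWeakStarTensor α) ∧
    ∀ (K : Type w) [NormedAddCommGroup K] [InnerProductSpace ℂ K] [CompleteSpace K]
      (α : AlgTensorVN (Enveloping A) (Enveloping B) →⋆ₐ[ℂ] (K →L[ℂ] K)),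
      IsMaxWeakStarTensor α →
      ∃ Φ : (Enveloping C).toStarSubalgebra ≃⋆ₐ[ℂ] weakStarTensor α,
        IsNormalMap Φ ∧ IsNormalMap Φ.symm ∧
        ∀ x : A ⊗[ℂ] B, Φ (toEnveloping C (ι x)) =
          toWeakStarTensor α (algTensorToEnveloping A B x) := by
  obtain ⟨α, hα, h⟩ := hι.exists_canonical hs
  exact ⟨⟨_, _, _, inferInstance, α, isMaxWeakStarTensor_canonical hι hα h⟩,
    fun K _ _ _ β hβ => exists_equiv_of_isMaxWeakStarTensor hι hα h hβ⟩

end Maximality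

end

theorem mainTheorem6 {A : Type u} {B : Type v} [NonUnitalCStarAlgebra A] [NonUnitalCStarAlgebra B]
    [Nontrivial A] [Nontrivial B] :
    (∃ (K : Type (max u v)) (_ : NormedAddCommGroup K) (_ : InnerProductSpace ℂ K)
      (_ : CompleteSpace K) (α : AlgTensorVN (Enveloping A) (Enveloping B) →⋆ₐ[ℂ] (K →L[ℂ] K)),
      IsMaxWeakStarTensor α) ∧
    ∀ (K : Type (max u v)) [NormedAddCommGroup K] [InnerProductSpace ℂ K] [CompleteSpace K]
      (α : AlgTensorVN (Enveloping A) (Enveloping B) →⋆ₐ[ℂ] (K →L[ℂ] K)),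
      IsMaxWeakStarTensor α →
      ∃ Φ : (Enveloping (MaxTensor A B)).toStarSubalgebra ≃⋆ₐ[ℂ] weakStarTensor α,
        IsNormalMap Φ ∧ IsNormalMap Φ.symm ∧
        ∀ x : A ⊗[ℂ] B, Φ (toEnveloping (MaxTensor A B) (MaxTensor.of x)) =
          toWeakStarTensor α (algTensorToEnveloping A B x) :=
  MaxTensor.isMaximalProduct.exists_max_and_equiv (exists_isSpatial A B)
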